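/- All digraphs are finite and loopless and may have multiple arcs. A rooted digraph $D=(V+r,A)$ has a root $r\notin V$ of in-degree $0$. For $j\ge 1$, $D$ is $j$-root-connected if $d_D^-(X)\ge j$ for all $\emptyset\ne X\subseteq V$, where $d_D^-(X)$ is the number of arcs entering $X$; root-connected means $1$-root-connected. An $r$-arborescence is a digraph whose underlying graph is a tree, in which $r$ has in-degree $0$ and every other vertex has in-degree $1$. For a positive integer $k$, an $r$-arborescence $X$ is $k$-safe if, for every vertex $v\neq r$ of $X$, at least $k$ vertices of $X$ lie outside the subarborescence of $X$ rooted at $v$. A vertex of $D$ (possibly $r$) is large if it has at least $6k-5$ distinct out-neighbours in $D$. A compact $(r,k)$-kernel of $D$ is a subdigraph $X=(V'+r,A')$ of $D$ with $|V'|\le 2k-2$ such that $X$ is an $r$-arborescence; every large vertex of $D$ that belongs to $V'+r$ is a sink of $X$; and a $k$-safe $r$-arborescence $Y$ (not necessarily a subdigraph of $D$) can be obtained from $X$ by adding $2k-2-|V'|$ new vertices and, for each new vertex $v$, one arc from some large vertex in $V'+r$ to $v$. A pair $(X_1,X_2)$ of subdigraphs $X_i=(V_i+r,A_i)$ of $D$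 is extendable if both $D-A_1$ and $D-A_2$ are root-connected. **Lemma 3.1 (compactsafe).** Let $k\ge 1$ and let $D=(V+r,A)$ be a $2$-root-connected rooted digraph with $|V|\ge 2k-2$. Then $D$ contains two arc-disjoint $k$-safe spanning $r$-arborescences if and only if $D$ contains an extendable pair of arc-disjoint compact $(r,k)$-kernels. Further, there is an algorithm that, given such $D$ and $k$ and an extendable pair of arc-disjoint compact $(r,k)$-kernels of $D$, finds a pair of arc-disjoint $k$-safe spanning $r$-arborescences of $D$ in time polynomial in the size $|V+r|+|A|$ of the input (where $k$ is part of the input and is not fixed). -/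

import Mathlib

universe u v

/-! ### Digraphs -/

/-- A loopless digraph, possibly with multiple arcs, with vertex set `V` and arc set `A`. -/
structure MultiDigraph (V : Type u) (A : Type v) where
  tail : A → V
  head : A → V
  loopless : ∀ a, tail a ≠ head a

namespace MultiDigraph

variable {V : Type u} {A : Type v}

/-- The arcs entering `S`. -/
def entering (D : MultiDigraph V A) (S : Set V) : Set A :=
  {a | D.tail a ∉ S ∧ D.head a ∈ S}

/-- The arcs leaving `S`. -/
def leaving (D : MultiDigraph V A) (S : Set V) : Set A :=
  {a | D.tail a ∈ S ∧ D.head a ∉ S}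

/-- The in-degree of a vertex set in a finite digraph. -/
noncomputable def inDeg (D : MultiDigraph V A) (S : Set V) : ℕ := (D.entering S).ncard

/-- The out-degree of a vertex set in a finite digraph. -/
noncomputable def outDeg (D : MultiDigraph V A) (S : Set V) : ℕ := (D.leaving S).ncard

/-- The set of (distinct) out-neighbours of a vertex. -/
def outNeighbors (D : MultiDigraph V A) (x : V) : Set V :=
  {y | ∃ a, D.tail a = x ∧ D.head a = y}

/-- A sink is a vertex of out-degree `0`. -/
def IsSink (D : MultiDigraph V A) (x : V) : Prop := D.outDeg {x} = 0

/-- The digraph on the same vertices obtained by deleting a set of arcs. -/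
def deleteArcs (D : MultiDigraph V A) (F : Set A) : MultiDigraph V {a : A // a ∉ F} where
  tail a := D.tail a.1
  head a := D.head a.1
  loopless a := D.loopless a.1

/-- With root `r`, every non-empty set of non-root vertices has in-degree at least `j`. -/
def IsRootConnected (D : MultiDigraph V A) (r : V) (j : ℕ) : Prop :=
  ∀ S : Set V, S.Nonempty → r ∉ S → j ≤ D.inDeg S

/-- The simple graph in which two vertices are adjacent when some arc joins them. -/
def underlying (D : MultiDigraph V A) : SimpleGraph V where
  Adj x y := ∃ a, (D.tail a = x ∧ D.head a = y) ∨ (D.tail a = y ∧ D.head a = x)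
  symm := ⟨fun _ _ ⟨a, h⟩ => ⟨a, h.symm⟩⟩
  loopless := ⟨fun x ⟨a, h⟩ => by
    rcases h with h | h <;> exact D.loopless a (h.1.trans h.2.symm)⟩

/-- The underlying multigraph (one edge per arc) is a tree: no two arcs give parallel edges, and
the simple graph that remains is a tree. -/
def UnderlyingIsTree (D : MultiDigraph V A) : Prop :=
  Function.Injective (fun a => s(D.tail a, D.head a)) ∧ D.underlying.IsTree

/-- An `r`-arborescence. -/
def IsArborescence (D : MultiDigraph V A) (r : V) : Prop :=
  D.UnderlyingIsTree ∧ D.inDeg {r} = 0 ∧ ∀ x, x ≠ r → D.inDeg {x} = 1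

/-- The vertices reachable from `x` by a directed path. In an arborescence this is the vertex set
of the subarborescence hanging from `x`. -/
def branch (D : MultiDigraph V A) (x : V) : Set V :=
  {y | Relation.ReflTransGen (fun p q => ∃ a, D.tail a = p ∧ D.head a = q) x y}

/-- A `k`-safe `r`-arborescence: for every `x ≠ r`, at least `k` vertices lie outside the
subarborescence hanging from `x`. -/
def IsSafeArborescence (D : MultiDigraph V A) (r : V) (k : ℕ) : Prop :=
  D.IsArborescence r ∧ ∀ x, x ≠ r → k ≤ Nat.card V - (D.branch x).ncard

/-- Add `t` new vertices to a digraph and, for each new vertex `i`, one arc from the old vertex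
`f i` to `i`. -/
def attachLeaves (D : MultiDigraph V A) {t : ℕ} (f : Fin t → V) :
    MultiDigraph (V ⊕ Fin t) (A ⊕ Fin t) where
  tail := Sum.elim (fun a => Sum.inl (D.tail a)) (fun i => Sum.inl (f i))
  head := Sum.elim (fun a => Sum.inl (D.head a)) (fun i => Sum.inr i)
  loopless := by
    rintro (a | i)
    · simpa using D.loopless a
    · simp

/-- A subdigraph: a set of vertices and a set of arcs all of whose ends are among the vertices. -/
@[ext]
structure Subdigraph (D : MultiDigraph V A) where
  verts : Set V
  arcs : Set A
  tail_mem : ∀ a ∈ arcs, D.tail a ∈ verts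
  head_mem : ∀ a ∈ arcs, D.head a ∈ verts

/-- A subdigraph as a digraph in its own right. -/
def Subdigraph.toDigraph {D : MultiDigraph V A} (X : D.Subdigraph) :
    MultiDigraph X.verts X.arcs where
  tail a := ⟨D.tail a.1, X.tail_mem a.1 a.2⟩
  head a := ⟨D.head a.1, X.head_mem a.1 a.2⟩
  loopless a h := D.loopless a.1 (congrArg Subtype.val h)

end MultiDigraph

/-- A rooted digraph: the root has in-degree `0`. -/
structure RootedDigraph (V : Type u) (A : Type v) extends MultiDigraph V A where
  root : V
  head_ne_root : ∀ a, head a ≠ root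

namespace RootedDigraph

variable {V : Type u} {A : Type v}

/-- The subdigraphs of (the digraph underlying) a rooted digraph. -/
abbrev Sub (D : RootedDigraph V A) := D.toMultiDigraph.Subdigraph

/-- Spanning subdigraphs that are `k`-safe arborescences rooted at the root of `D`. -/
def IsSafeSpanningArborescence (D : RootedDigraph V A) (k : ℕ) (T : D.Sub) : Prop :=
  T.verts = Set.univ ∧ ∃ hr : D.root ∈ T.verts, T.toDigraph.IsSafeArborescence ⟨D.root, hr⟩ k

/-- A vertex is large if it has at least `6k-5` out-neighbours (in `D`). -/
def IsLarge (D : RootedDigraph V A) (k : ℕ) (x : V) : Prop :=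
  6 * k - 5 ≤ (D.outNeighbors x).ncard

/-- Compact `(r,k)`-kernels. Here `X.verts \ {D.root}` is the set `V'` when the vertex set of
`X` is written as `V' + r`. -/
def IsCompactKernel (D : RootedDigraph V A) (k : ℕ) (X : D.Sub) : Prop :=
  ∃ hr : D.root ∈ X.verts,
    (X.verts \ {D.root}).ncard ≤ 2 * k - 2 ∧
    X.toDigraph.IsArborescence ⟨D.root, hr⟩ ∧
    (∀ x : X.verts, D.IsLarge k x.1 → X.toDigraph.IsSink x) ∧
    ∃ f : Fin (2 * k - 2 - (X.verts \ {D.root}).ncard) → X.verts,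
      (∀ i, D.IsLarge k (f i).1) ∧
      (X.toDigraph.attachLeaves f).IsSafeArborescence (Sum.inl ⟨D.root, hr⟩) k

/-- A pair of subdigraphs is extendable if deleting the arcs of either one leaves a
root-connected digraph. -/
def IsExtendable (D : RootedDigraph V A) (X₁ X₂ : D.Sub) : Prop :=
  (D.deleteArcs X₁.arcs).IsRootConnected D.root 1 ∧
  (D.deleteArcs X₂.arcs).IsRootConnected D.root 1

/-- An extendable pair of arc-disjoint compact `(r,k)`-kernels. -/
def IsCompactKernelPair (D : RootedDigraph V A) (k : ℕ) (X₁ X₂ : D.Sub) : Prop :=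
  D.IsCompactKernel k X₁ ∧ D.IsCompactKernel k X₂ ∧ Disjoint X₁.arcs X₂.arcs ∧
    D.IsExtendable X₁ X₂

/-- A pair of arc-disjoint `k`-safe spanning `r`-arborescences. -/
def IsSafePacking (D : RootedDigraph V A) (k : ℕ) (T₁ T₂ : D.Sub) : Prop :=
  D.IsSafeSpanningArborescence k T₁ ∧ D.IsSafeSpanningArborescence k T₂ ∧
    Disjoint T₁.arcs T₂.arcs

end RootedDigraph

/-! ### Random access machines

Structured programs for a unit-cost random access machine whose registers hold natural numbers.
There are scalar registers and, for indirect addressing, arrays. The only arithmetic operations are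
addition and truncated subtraction, so that in `t` steps numbers reach bit length `O(t)` only;
hence unit-cost polynomial time is the usual polynomial time. -/

namespace RAM

/-- Memory: scalar registers and arrays. -/
@[ext]
structure State where
  var : ℕ → ℕ
  arr : ℕ → ℕ → ℕ

/-- Arithmetic expressions. `Expr.get b e` is the entry of array `b` at the index given by `e`. -/
inductive Expr where
  | const (c : ℕ)
  | var (x : ℕ)
  | get (b : ℕ) (e : Expr)
  | add (e₁ e₂ : Expr)
  | sub (e₁ e₂ : Expr)

/-- The value of an expression. -/
def Expr.eval (s : State) : Expr → ℕ
  | const c => c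
  | var x => s.var x
  | get b e => s.arr b (e.eval s)
  | add e₁ e₂ => e₁.eval s + e₂.eval s
  | sub e₁ e₂ => e₁.eval s - e₂.eval s

/-- Tests. -/
inductive Test where
  | eq (e₁ e₂ : Expr)
  | lt (e₁ e₂ : Expr)
  | not (b : Test)
  | and (b₁ b₂ : Test)

/-- The truth value of a test. -/
def Test.Holds (s : State) : Test → Prop
  | eq e₁ e₂ => e₁.eval s = e₂.eval s
  | lt e₁ e₂ => e₁.eval s < e₂.eval s
  | not b => ¬ b.Holds s
  | and b₁ b₂ => b₁.Holds s ∧ b₂.Holds s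

/-- Assign to a scalar register. -/
def State.setVar (s : State) (x n : ℕ) : State :=
  { s with var := Function.update s.var x n }

/-- Assign to an array entry. -/
def State.setArr (s : State) (b i n : ℕ) : State :=
  { s with arr := Function.update s.arr b (Function.update (s.arr b) i n) }

/-- Programs. `set x e` is `x := e`, and `put b i e` is `b[i] := e`. -/
inductive Prog where
  | skip
  | set (x : ℕ) (e : Expr)
  | put (b : ℕ) (i e : Expr)
  | seq (P Q : Prog)
  | ite (b : Test) (P Q : Prog)
  | loop (b : Test) (P : Prog)

/-- `Exec P s s' t`: the program `P`, started in the state `s`, halts in the state `s'` after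
exactly `t` steps. Each executed assignment and each evaluated test is one step (the expressions in
a program are fixed with the program, so evaluating one is a bounded number of elementary
operations). `loop b P` repeats `P` as long as `b` holds. -/
inductive Exec : Prog → State → State → ℕ → Prop
  | skip (s : State) : Exec Prog.skip s s 1
  | set (s : State) (x : ℕ) (e : Expr) : Exec (Prog.set x e) s (s.setVar x (e.eval s)) 1
  | put (s : State) (b : ℕ) (i e : Expr) :
      Exec (Prog.put b i e) s (s.setArr b (i.eval s) (e.eval s)) 1
  | seq {P Q : Prog} {s s' s'' : State} {t t' : ℕ} :
      Exec P s s' t → Exec Q s' s'' t' → Exec (Prog.seq P Q) s s'' (t + t')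
  | ite_true {b : Test} {P Q : Prog} {s s' : State} {t : ℕ} :
      b.Holds s → Exec P s s' t → Exec (Prog.ite b P Q) s s' (t + 1)
  | ite_false {b : Test} {P Q : Prog} {s s' : State} {t : ℕ} :
      ¬ b.Holds s → Exec Q s s' t → Exec (Prog.ite b P Q) s s' (t + 1)
  | loop_true {b : Test} {P : Prog} {s s' s'' : State} {t t' : ℕ} :
      b.Holds s → Exec P s s' t → Exec (Prog.loop b P) s' s'' t' →
        Exec (Prog.loop b P) s s'' (t + t' + 1)
  | loop_false {b : Test} {P : Prog} {s : State} :
      ¬ b.Holds s → Exec (Prog.loop b P) s s 1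

/-- An array holding the values of `g` in its first `n` entries, and `0` afterwards. -/
def tabulate {n : ℕ} (g : Fin n → ℕ) : ℕ → ℕ :=
  fun i => if h : i < n then g ⟨i, h⟩ else 0

open Classical in
/-- An array holding the characteristic vector of `S`. -/
noncomputable def indicator {n : ℕ} (S : Set (Fin n)) : ℕ → ℕ :=
  tabulate fun i => if i ∈ S then 1 else 0

/-- The input memory for a rooted digraph with `n` vertices and `m` arcs, a number `k` and two
subdigraphs. Registers `0, 1, 2, 3` hold `n`, `m`, the root and `k`; arrays `0` and `1` hold the
tails and the heads of the arcs, arrays `2` and `3` the arc sets of the two subdigraphs, arrays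
`4` and `5` their vertex sets. All other memory is `0`. -/
noncomputable def inputState {n m : ℕ} (D : RootedDigraph (Fin n) (Fin m)) (k : ℕ)
    (X₁ X₂ : D.Sub) : State where
  var x := match x with
    | 0 => n
    | 1 => m
    | 2 => D.root
    | 3 => k
    | _ => 0
  arr b := match b with
    | 0 => tabulate fun a => (D.tail a : ℕ)
    | 1 => tabulate fun a => (D.head a : ℕ)
    | 2 => indicator X₁.arcs
    | 3 => indicator X₂.arcs
    | 4 => indicator X₁.verts
    | 5 => indicator X₂.verts
    | _ => fun _ => 0

/-- The memory `s` holds the sets `F₁`, `F₂` as output: the first `m` entries of the arrays `0` and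
`1` are their characteristic vectors. -/
def OutputIs {m : ℕ} (s : State) (F₁ F₂ : Set (Fin m)) : Prop :=
  ∀ a : Fin m, s.arr 0 a = indicator F₁ a ∧ s.arr 1 a = indicator F₂ a

end RAM

/-! From a packing to kernels: a safe tree with more than `2k-1` vertices has a leaf whose removal
keeps it safe (`IsTree.exists_safe_subtree`). Once `2k-1` vertices remain, everything strictly below
a large vertex is cut off, and each lost vertex is replaced by a new leaf hung from a large vertex
that was above it, so no branch grows (`IsTree.exists_kernel`). Each kernel lies inside its own
arborescence, so deleting its arcs leaves the other arborescence intact; hence the pair is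
extendable.

From kernels to a packing: keep two arc-disjoint trees such that deleting either one leaves every
vertex reachable (`IsPair`), and add arcs one at a time. Below `2k-1` vertices the new arc leaves a
large vertex of the kernel. A count of leaf slots shows that some large vertex still has room in all
branches containing it (`IsKernelTree.exists_large`), and largeness provides an unblocked arc at
that vertex (`IsTree.exists_arc_of_outNeighbors`), because tight sets of distinct blocked arcs with
a common tail are disjoint. From `2k-1` vertices on, Lovász's argument for Edmonds' theorem supplies
the arc (`IsPair.exists_arc`). Safety then persists, since a new leaf enlarges a branch by at most
one and the whole tree by exactly one. Both trees must reach `2k-1` vertices before either becomes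
spanning, because the largeness bound needs both to be small.

For the algorithm, `IsAdmissible` mentions only conditions that graph search can test, and
`IsGreedy` says that every admissible arc, not just the one found in the existence proof, preserves
the invariant. Thus scanning for any admissible arc succeeds without backtracking, and four such
runs produce the packing in polynomial time. -/

/-! ### Reachability inside arc sets -/

namespace MultiDigraph

variable {V : Type u} {A : Type v}

/-- Some arc of `F` goes from `p` to `q`. -/
def ArcRel (D : MultiDigraph V A) (F : Set A) (p q : V) : Prop :=
  ∃ a ∈ F, D.tail a = p ∧ D.head a = q

/-- The vertices reachable from `x` by a directed path with all arcs in `F`. -/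
def reach (D : MultiDigraph V A) (F : Set A) (x : V) : Set V :=
  {y | Relation.ReflTransGen (D.ArcRel F) x y}

variable {D : MultiDigraph V A} {F F' : Set A} {x y z : V}

theorem arcRel_of_mem {a : A} (ha : a ∈ F) : D.ArcRel F (D.tail a) (D.head a) :=
  ⟨a, ha, rfl, rfl⟩

theorem mem_reach_self : x ∈ D.reach F x := Relation.ReflTransGen.refl

theorem reach_trans (hy : y ∈ D.reach F x) (hz : z ∈ D.reach F y) : z ∈ D.reach F x :=
  Relation.ReflTransGen.trans hy hz

theorem reach_subset_reach (hy : y ∈ D.reach F x) : D.reach F y ⊆ D.reach F x :=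
  fun _ hz => reach_trans hy hz

theorem head_mem_reach {a : A} (ha : a ∈ F) (h : D.tail a ∈ D.reach F x) :
    D.head a ∈ D.reach F x :=
  Relation.ReflTransGen.tail h (arcRel_of_mem ha)

theorem reach_mono (h : F ⊆ F') (x : V) : D.reach F x ⊆ D.reach F' x := by
  intro y hy
  refine Relation.ReflTransGen.mono ?_ x y hy
  rintro p q ⟨a, ha, h1⟩
  exact ⟨a, h ha, h1⟩

/-- A set containing `x` and closed under the arcs of `F` contains all that `x` reaches. -/
theorem reach_subset_of_closed {S : Set V} (hx : x ∈ S)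
    (hS : ∀ a ∈ F, D.tail a ∈ S → D.head a ∈ S) : D.reach F x ⊆ S := by
  intro y hy
  change Relation.ReflTransGen _ _ _ at hy
  induction hy with
  | refl => exact hx
  | tail _ h ih =>
    obtain ⟨a, ha, rfl, rfl⟩ := h
    exact hS a ha ih

theorem exists_tail_of_mem_reach (hy : y ∈ D.reach F x) (hne : y ≠ x) :
    ∃ a ∈ F, D.head a = y ∧ D.tail a ∈ D.reach F x := by
  change Relation.ReflTransGen _ _ _ at hy
  rcases Relation.ReflTransGen.cases_tail hy with h | ⟨p, hp, a, ha, rfl, rfl⟩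
  · exact absurd h hne
  · exact ⟨a, ha, rfl, hp⟩

/-- Every vertex is reachable iff every set avoiding the root is entered. -/
theorem forall_mem_reach_iff :
    (∀ y, y ∈ D.reach F x) ↔
      ∀ S : Set V, S.Nonempty → x ∉ S → ∃ a ∈ F, a ∈ D.entering S := by
  constructor
  · rintro h S ⟨y, hy⟩ hx
    by_contra hno
    push Not at hno
    have : D.reach F x ⊆ Sᶜ := reach_subset_of_closed hx fun a ha h1 h2 => hno a ha ⟨h1, h2⟩
    exact this (h y) hy
  · intro h y
    by_contra hy
    obtain ⟨a, ha, h1, h2⟩ := h (D.reach F x)ᶜ ⟨y, hy⟩ (fun h => h mem_reach_self)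
    simp only [Set.mem_compl_iff, not_not] at h1
    exact h2 (head_mem_reach ha h1)

theorem branch_eq_reach (D : MultiDigraph V A) (x : V) : D.branch x = D.reach Set.univ x := by
  have : (fun p q => ∃ a, D.tail a = p ∧ D.head a = q) = D.ArcRel Set.univ := by
    funext p q
    simp [ArcRel]
  simp only [branch, reach, this]

theorem mem_entering_singleton {a : A} : a ∈ D.entering {x} ↔ D.head a = x := by
  constructor
  · exact fun h => h.2
  · rintro rfl
    exact ⟨D.loopless a, rfl⟩

theorem mem_leaving_singleton {a : A} : a ∈ D.leaving {x} ↔ D.tail a = x := by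
  constructor
  · exact fun h => h.1
  · rintro rfl
    exact ⟨rfl, (D.loopless a).symm⟩

theorem isSink_iff [Finite A] : D.IsSink x ↔ ∀ a, D.tail a ≠ x := by
  rw [IsSink, outDeg, Set.ncard_eq_zero, Set.eq_empty_iff_forall_notMem]
  simp only [mem_leaving_singleton, ne_eq]

theorem inDeg_singleton_eq_zero_iff [Finite A] : D.inDeg {x} = 0 ↔ ∀ a, D.head a ≠ x := by
  rw [inDeg, Set.ncard_eq_zero, Set.eq_empty_iff_forall_notMem]
  simp only [mem_entering_singleton, ne_eq]

theorem card_le_of_head [Finite V] {r : V} (hr : ∀ a, D.head a ≠ r)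
    (hinj : Function.Injective D.head) : Nat.card A + 1 ≤ Nat.card V := by
  have h1 : Set.ncard (Set.range D.head) = Nat.card A := by
    rw [← Set.image_univ, Set.ncard_image_of_injective _ hinj, Set.ncard_univ]
  have h2 : (insert r (Set.range D.head)).ncard = (Set.range D.head).ncard + 1 :=
    Set.ncard_insert_of_notMem (by rintro ⟨a, ha⟩; exact hr a ha)
  rw [← h1, ← h2]
  exact Set.ncard_le_card _

/-- Arborescences are the digraphs in which no arc enters the root, no two arcs enter the same
vertex, and everything is reachable from the root. -/
theorem isArborescence_iff [Finite V] [Finite A] {r : V} :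
    D.IsArborescence r ↔
      (∀ a, D.head a ≠ r) ∧ Function.Injective D.head ∧ ∀ y, y ∈ D.reach Set.univ r := by
  constructor
  · rintro ⟨⟨-, htree⟩, h0, h1⟩
    rw [inDeg_singleton_eq_zero_iff] at h0
    have hinj : Function.Injective D.head := by
      intro a b hab
      obtain ⟨c, hc⟩ := Set.ncard_eq_one.1 (h1 (D.head a) (h0 a))
      have ha : a ∈ D.entering {D.head a} := mem_entering_singleton.2 rfl
      have hb : b ∈ D.entering {D.head a} := mem_entering_singleton.2 hab.symm
      rw [hc] at ha hb
      exact ha.trans hb.symm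
    refine ⟨h0, hinj, fun y => ?_⟩
    have hwalk : Relation.ReflTransGen D.underlying.Adj r y :=
      (SimpleGraph.reachable_iff_reflTransGen r y).1 (htree.1.preconnected r y)
    induction hwalk with
    | refl => exact mem_reach_self
    | tail _ h ih =>
      obtain ⟨a, ⟨rfl, rfl⟩ | ⟨rfl, rfl⟩⟩ := h
      · exact head_mem_reach (Set.mem_univ a) ih
      -- Here the walk uses `a` backwards. Its head is reached from the root through some arc `b`,
      -- and uniqueness of the entering arc gives `b = a`, so the tail is reached too.
      · obtain ⟨b, -, hb, hb'⟩ := exists_tail_of_mem_reach ih (h0 a)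
        rwa [← hinj hb]
  · rintro ⟨h0, hinj, hreach⟩
    have hconn : D.underlying.Connected := by
      have : Nonempty V := ⟨r⟩
      have hr : ∀ y, D.underlying.Reachable r y := by
        intro y
        have hy : Relation.ReflTransGen (D.ArcRel Set.univ) r y := hreach y
        rw [SimpleGraph.reachable_iff_reflTransGen]
        refine Relation.ReflTransGen.mono ?_ r y hy
        rintro p q ⟨a, -, h⟩
        exact ⟨a, Or.inl h⟩
      exact ⟨fun y z => (hr y).symm.trans (hr z)⟩
    let e : A → D.underlying.edgeSet := fun a =>
      ⟨s(D.tail a, D.head a), a, Or.inl ⟨rfl, rfl⟩⟩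
    have hsurj : Function.Surjective e := by
      rintro ⟨⟨p, q⟩, a, ⟨h1, h2⟩ | ⟨h1, h2⟩⟩
      · exact ⟨a, Subtype.ext (congrArg₂ (fun x y => s(x, y)) h1 h2)⟩
      · exact ⟨a, Subtype.ext ((congrArg₂ (fun x y => s(x, y)) h1 h2).trans Sym2.eq_swap)⟩
    -- Connectivity gives `|V| - 1 ≤ |edges|`, surjectivity `|edges| ≤ |A|`, and distinct heads
    -- avoiding the root `|A| ≤ |V| - 1`. Equality throughout excludes parallel arcs and makes the
    -- graph a tree.
    have hcard := card_le_of_head h0 hinj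
    have hconn' := hconn.card_vert_le_card_edgeSet_add_one
    have hle : Nat.card D.underlying.edgeSet ≤ Nat.card A := Nat.card_le_card_of_surjective e hsurj
    have hbij : Function.Bijective e :=
      (Nat.bijective_iff_surjective_and_card e).2 ⟨hsurj, by omega⟩
    refine ⟨⟨?_, SimpleGraph.isTree_iff_connected_and_card.2 ⟨hconn, by omega⟩⟩,
      inDeg_singleton_eq_zero_iff.2 h0, ?_⟩
    · intro a b hab
      exact hbij.1 (Subtype.ext hab)
    · intro x hx
      obtain ⟨a, -, ha, -⟩ := exists_tail_of_mem_reach (hreach x) hx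
      rw [inDeg, Set.ncard_eq_one]
      refine ⟨a, Set.eq_singleton_iff_unique_mem.2 ⟨mem_entering_singleton.2 ha, fun b hb => ?_⟩⟩
      exact hinj ((mem_entering_singleton.1 hb).trans ha.symm)

/-- Translates branches living on the subtype of vertices into `reach` in the ambient digraph, where
trees with different vertex sets can be compared. -/
theorem Subdigraph.image_branch (X : D.Subdigraph) (w : X.verts) :
    Subtype.val '' X.toDigraph.branch w = D.reach X.arcs w.1 := by
  rw [branch_eq_reach]
  apply Set.Subset.antisymm
  · rw [Set.image_subset_iff]
    refine reach_subset_of_closed (mem_reach_self (D := D)) fun a _ h => ?_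
    exact head_mem_reach (D := D) a.2 h
  · refine reach_subset_of_closed ⟨w, mem_reach_self, rfl⟩ ?_
    rintro a ha ⟨q, hq, hqa⟩
    refine ⟨⟨D.head a, X.head_mem a ha⟩, ?_, rfl⟩
    refine head_mem_reach (D := X.toDigraph) (Set.mem_univ (⟨a, ha⟩ : X.arcs)) ?_
    have : X.toDigraph.tail ⟨a, ha⟩ = q := Subtype.ext hqa.symm
    rwa [this]

theorem Subdigraph.ncard_branch (X : D.Subdigraph) (w : X.verts) :
    (X.toDigraph.branch w).ncard = (D.reach X.arcs w.1).ncard := by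
  rw [← X.image_branch, Set.ncard_image_of_injective _ Subtype.val_injective]

theorem attachLeaves_inl_mem_branch {t : ℕ} {f : Fin t → V} :
    Sum.inl y ∈ (D.attachLeaves f).branch (Sum.inl x) ↔ y ∈ D.branch x := by
  rw [branch_eq_reach, branch_eq_reach]
  constructor
  · intro h
    have : (D.attachLeaves f).reach Set.univ (Sum.inl x) ⊆
        {z | ∀ y, z = Sum.inl y → y ∈ D.reach Set.univ x} := by
      refine reach_subset_of_closed ?_ ?_
      · rintro y h
        obtain rfl := Sum.inl.inj h
        exact mem_reach_self
      · rintro (a | i) - h1 y h2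
        · obtain rfl : D.head a = y := Sum.inl.inj h2
          exact head_mem_reach (Set.mem_univ a) (h1 _ rfl)
        · exact absurd h2 (by simp [attachLeaves])
    exact this h y rfl
  · intro h
    have : D.reach Set.univ x ⊆
        {y | Sum.inl y ∈ (D.attachLeaves f).reach Set.univ (Sum.inl x)} := by
      refine reach_subset_of_closed mem_reach_self fun a _ h1 => ?_
      exact head_mem_reach (D := D.attachLeaves f) (Set.mem_univ (Sum.inl a)) h1
    exact this h

theorem attachLeaves_inr_mem_branch {t : ℕ} {f : Fin t → V} {i : Fin t} :
    Sum.inr i ∈ (D.attachLeaves f).branch (Sum.inl x) ↔ f i ∈ D.branch x := by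
  constructor
  · intro h
    rw [branch_eq_reach] at h
    obtain ⟨a | j, -, h1, h2⟩ := exists_tail_of_mem_reach h (by simp)
    · exact absurd h1 (by simp [attachLeaves])
    · obtain rfl : j = i := Sum.inr.inj h1
      rw [← branch_eq_reach] at h2
      exact attachLeaves_inl_mem_branch.1 h2
  · intro h
    have h' := attachLeaves_inl_mem_branch (f := f).2 h
    rw [branch_eq_reach] at h' ⊢
    exact head_mem_reach (D := D.attachLeaves f) (Set.mem_univ (Sum.inr i)) h'

theorem attachLeaves_branch_inr {t : ℕ} {f : Fin t → V} {i : Fin t} :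
    (D.attachLeaves f).branch (Sum.inr i) = {Sum.inr i} := by
  rw [branch_eq_reach]
  refine Set.Subset.antisymm (reach_subset_of_closed rfl ?_)
    (Set.singleton_subset_iff.2 mem_reach_self)
  rintro (a | j) - h <;> exact absurd h (by simp [attachLeaves])

theorem attachLeaves_ncard_branch [Finite V] {t : ℕ} (f : Fin t → V) (x : V) :
    ((D.attachLeaves f).branch (Sum.inl x)).ncard =
      (D.branch x).ncard + {i | f i ∈ D.branch x}.ncard := by
  have : (D.attachLeaves f).branch (Sum.inl x) =
      Sum.inl '' D.branch x ∪ Sum.inr '' {i | f i ∈ D.branch x} := by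
    ext (y | i)
    · simp [attachLeaves_inl_mem_branch]
    · simp [attachLeaves_inr_mem_branch]
  rw [this, Set.ncard_union_eq, Set.ncard_image_of_injective _ Sum.inl_injective,
    Set.ncard_image_of_injective _ Sum.inr_injective]
  rw [Set.disjoint_left]
  rintro _ ⟨y, -, rfl⟩ ⟨i, -, h⟩
  cases h

theorem IsArborescence.attachLeaves [Finite V] [Finite A] {r : V} (h : D.IsArborescence r) {t : ℕ}
    (f : Fin t → V) : (D.attachLeaves f).IsArborescence (Sum.inl r) := by
  rw [isArborescence_iff] at h ⊢
  obtain ⟨h0, hinj, hreach⟩ := h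
  refine ⟨?_, ?_, ?_⟩
  · rintro (a | i) h
    · exact h0 a (Sum.inl.inj h)
    · cases h
  · rintro (a | i) (b | j) h
    · exact congrArg Sum.inl (hinj (Sum.inl.inj h))
    · cases h
    · cases h
    · exact congrArg Sum.inr (Sum.inr.inj h)
  · simp only [← branch_eq_reach] at hreach ⊢
    rintro (y | i)
    · exact attachLeaves_inl_mem_branch.2 (hreach y)
    · exact attachLeaves_inr_mem_branch.2 (hreach _)

end MultiDigraph

/-! ### Rooted trees given by an arc set and a vertex set -/

namespace RootedDigraph

open MultiDigraph

variable {V : Type u} {A : Type v}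

/-- The arc set `F` and the vertex set `U` form an arborescence rooted at the root of `D`. -/
structure IsTree (D : RootedDigraph V A) (F : Set A) (U : Set V) : Prop where
  root_mem : D.root ∈ U
  tail_mem : ∀ a ∈ F, D.tail a ∈ U
  head_mem : ∀ a ∈ F, D.head a ∈ U
  inj : Set.InjOn D.head F
  subset_reach : U ⊆ D.reach F D.root

/-- All vertices are reachable from the root by arcs of `F`. -/
def Spans (D : RootedDigraph V A) (F : Set A) : Prop := ∀ y, y ∈ D.reach F D.root

variable {D : RootedDigraph V A} {F F' : Set A} {U W : Set V} {x y z : V}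

theorem isTree_iff_isArborescence [Finite V] [Finite A] {X : D.Sub} (hr : D.root ∈ X.verts) :
    X.toDigraph.IsArborescence ⟨D.root, hr⟩ ↔ D.IsTree X.arcs X.verts := by
  rw [isArborescence_iff]
  have key : ∀ y : X.verts, y ∈ X.toDigraph.reach Set.univ ⟨D.root, hr⟩ ↔
      y.1 ∈ D.reach X.arcs D.root := by
    intro y
    rw [← X.image_branch ⟨D.root, hr⟩, branch_eq_reach]
    exact (Function.Injective.mem_set_image Subtype.val_injective).symm
  simp only [key]
  constructor
  · rintro ⟨-, h1, h2⟩
    refine ⟨hr, X.tail_mem, X.head_mem, ?_, fun y hy => h2 ⟨y, hy⟩⟩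
    intro a ha b hb hab
    exact congrArg Subtype.val (@h1 ⟨a, ha⟩ ⟨b, hb⟩ (Subtype.ext hab))
  · intro h
    refine ⟨fun a ha => D.head_ne_root a.1 (congrArg Subtype.val ha), ?_,
      fun y => h.subset_reach y.2⟩
    intro a b hab
    exact Subtype.ext (h.inj a.2 b.2 (congrArg Subtype.val hab))

theorem spans_mono (h : F ⊆ F') (hF : D.Spans F) : D.Spans F' :=
  fun y => reach_mono h _ (hF y)

theorem spans_iff :
    D.Spans F ↔ ∀ S : Set V, S.Nonempty → D.root ∉ S → ∃ a ∈ F, a ∈ D.entering S :=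
  forall_mem_reach_iff

theorem deleteArcs_isRootConnected_iff [Finite A] :
    (D.deleteArcs F).IsRootConnected D.root 1 ↔ D.Spans Fᶜ := by
  rw [spans_iff]
  refine forall_congr' fun S => imp_congr Iff.rfl (imp_congr Iff.rfl ?_)
  rw [inDeg, Nat.one_le_iff_ne_zero, Ne, Set.ncard_eq_zero, ← Ne, ← Set.nonempty_iff_ne_empty]
  constructor
  · rintro ⟨a, ha⟩
    exact ⟨a.1, a.2, ha⟩
  · rintro ⟨a, ha, h⟩
    exact ⟨⟨a, ha⟩, h⟩

theorem _root_.MultiDigraph.IsRootConnected.exists_ne {D : MultiDigraph V A} {r : V} [Finite A]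
    (h : D.IsRootConnected r 2) {S : Set V} (hS : S.Nonempty) (hr : r ∉ S) :
    ∃ a ∈ D.entering S, ∃ b ∈ D.entering S, a ≠ b := by
  have := h S hS hr
  obtain ⟨a, ha, b, hb, hab⟩ :=
    (Set.one_lt_ncard (Set.toFinite _)).1 (show 1 < (D.entering S).ncard from this)
  exact ⟨a, ha, b, hb, hab⟩

/-- The subdigraph formed by a tree. -/
def IsTree.toSub (h : D.IsTree F U) : D.Sub := ⟨U, F, h.tail_mem, h.head_mem⟩

namespace IsTree

/-- Induction along the path from the root to `x`: a cycle through a vertex must use its only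
entering arc, hence also passes through its parent, and the root has no entering arc. -/
theorem not_transGen (h : D.IsTree F U) (hx : x ∈ U) :
    ¬ Relation.TransGen (D.ArcRel F) x x := by
  have hx' : Relation.ReflTransGen (D.ArcRel F) D.root x := h.subset_reach hx
  clear hx
  induction hx' with
  | refl =>
    intro hc
    obtain ⟨p, -, a, -, -, ha⟩ := Relation.TransGen.tail'_iff.1 hc
    exact D.head_ne_root a ha
  | tail _ hpq ih =>
    intro hc
    obtain ⟨p', hp', b, hb, rfl, hb'⟩ := Relation.TransGen.tail'_iff.1 hc
    obtain ⟨a, ha, rfl, rfl⟩ := hpq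
    obtain rfl := h.inj hb ha hb'
    exact ih (Relation.TransGen.head'_iff.2 ⟨_, arcRel_of_mem ha, hp'⟩)

theorem antisymm (h : D.IsTree F U) (hx : x ∈ U) (hxy : y ∈ D.reach F x) (hyx : x ∈ D.reach F y) :
    x = y := by
  by_contra hne
  change Relation.ReflTransGen _ _ _ at hxy
  rcases Relation.reflTransGen_iff_eq_or_transGen.1 hxy with h1 | h1
  · exact hne h1.symm
  · exact h.not_transGen hx (h1.trans_left hyx)

theorem tail_notMem_reach_head (h : D.IsTree F U) {a : A} (ha : a ∈ F) :
    D.tail a ∉ D.reach F (D.head a) := fun hc =>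
  D.loopless a (h.antisymm (h.tail_mem a ha) (head_mem_reach ha mem_reach_self) hc)

theorem reach_subset (h : D.IsTree F U) (hx : x ∈ U) : D.reach F x ⊆ U :=
  reach_subset_of_closed hx fun a ha _ => h.head_mem a ha

theorem reach_eq_singleton (h : D.IsTree F U) (hx : x ∉ U) : D.reach F x = {x} := by
  refine Set.Subset.antisymm (reach_subset_of_closed rfl ?_)
    (Set.singleton_subset_iff.2 mem_reach_self)
  rintro a ha rfl
  exact absurd (h.tail_mem a ha) hx

theorem root_notMem_reach (hx : x ≠ D.root) : D.root ∉ D.reach F x := by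
  intro h
  obtain ⟨a, -, ha, -⟩ := exists_tail_of_mem_reach h hx.symm
  exact D.head_ne_root a ha

/-- Two vertices with a common descendant are comparable. -/
theorem total (h : D.IsTree F U) (hx : z ∈ D.reach F x) (hy : z ∈ D.reach F y) :
    x ∈ D.reach F y ∨ y ∈ D.reach F x := by
  -- Reversing the arcs gives a partial function, so the ancestors of `z` form a chain.
  have hu : Relator.RightUnique (Function.swap (D.ArcRel F)) := by
    rintro p q q' ⟨a, ha, rfl, rfl⟩ ⟨b, hb, rfl, hab⟩
    rw [h.inj ha hb hab.symm]
  rcases Relation.ReflTransGen.total_of_right_unique hu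
    (Relation.reflTransGen_swap.2 hx) (Relation.reflTransGen_swap.2 hy) with h1 | h1
  · exact Or.inl (Relation.reflTransGen_swap.1 h1)
  · exact Or.inr (Relation.reflTransGen_swap.1 h1)

/-- The predecessor closure of a subtree inside a tree. -/
theorem mem_of_mem_reach (hX : D.IsTree F' W) (h : D.IsTree F U) (hF : F' ⊆ F)
    (hz : z ∈ D.reach F x) (hzW : z ∈ W) : x ∈ W := by
  change Relation.ReflTransGen _ _ _ at hz
  induction hz with
  | refl => exact hzW
  | tail _ hpq ih =>
    obtain ⟨a, ha, rfl, rfl⟩ := hpq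
    obtain ⟨b, hb, hb', -⟩ :=
      exists_tail_of_mem_reach (hX.subset_reach hzW) (D.head_ne_root a)
    obtain rfl := h.inj (hF hb) ha hb'
    exact ih (hX.tail_mem b hb)

/-- A vertex of the subtree has the same parent in both trees, so a path of the big tree ending in
`W` already runs inside the subtree. -/
theorem reach_inter (hX : D.IsTree F' W) (h : D.IsTree F U) (hF : F' ⊆ F) (hx : x ∈ W) :
    D.reach F x ∩ W = D.reach F' x := by
  apply Set.Subset.antisymm
  · rintro z ⟨hz, hzW⟩
    change Relation.ReflTransGen _ _ _ at hz
    induction hz with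
    | refl => exact mem_reach_self
    | tail _ hpq ih =>
      obtain ⟨a, ha, rfl, rfl⟩ := hpq
      obtain ⟨b, hb, hb', -⟩ :=
        exists_tail_of_mem_reach (hX.subset_reach hzW) (D.head_ne_root a)
      obtain rfl := h.inj (hF hb) ha hb'
      exact head_mem_reach hb (ih (hX.tail_mem b hb))
  · exact fun z hz => ⟨reach_mono hF _ hz, hX.reach_subset hx hz⟩

/-- Restricting a tree to a set of vertices closed under predecessors. -/
theorem restrict (h : D.IsTree F U) (hr : D.root ∈ W) (hWU : W ⊆ U)
    (hW : ∀ a ∈ F, D.head a ∈ W → D.tail a ∈ W) : D.IsTree {a ∈ F | D.head a ∈ W} W := by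
  refine ⟨hr, fun a ha => hW a ha.1 ha.2, fun a ha => ha.2, h.inj.mono fun a ha => ha.1, ?_⟩
  intro z hzW
  have hz := h.subset_reach (hWU hzW)
  change Relation.ReflTransGen _ _ _ at hz
  induction hz with
  | refl => exact mem_reach_self
  | tail _ hpq ih =>
    obtain ⟨a, ha, rfl, rfl⟩ := hpq
    exact head_mem_reach (F := {a ∈ F | D.head a ∈ W}) ⟨ha, hzW⟩ (ih (hW a ha hzW))

theorem insert_arc (h : D.IsTree F U) {a : A} (ht : D.tail a ∈ U) (hh : D.head a ∉ U) :
    D.IsTree (insert a F) (insert (D.head a) U) := by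
  refine ⟨Or.inr h.root_mem, ?_, ?_, ?_, ?_⟩
  · rintro b (rfl | hb)
    · exact Or.inr ht
    · exact Or.inr (h.tail_mem b hb)
  · rintro b (rfl | hb)
    · exact Or.inl rfl
    · exact Or.inr (h.head_mem b hb)
  · have key : ∀ b ∈ F, D.head b ≠ D.head a := fun b hb hc => hh (hc ▸ h.head_mem b hb)
    rintro b (rfl | hb) c (rfl | hc) hbc
    · rfl
    · exact absurd hbc.symm (key c hc)
    · exact absurd hbc (key b hb)
    · exact h.inj hb hc hbc
  · have hsub : U ⊆ D.reach (insert a F) D.root :=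
      h.subset_reach.trans (reach_mono (Set.subset_insert a F) _)
    rintro y (rfl | hy)
    · exact head_mem_reach (Set.mem_insert a F) (hsub ht)
    · exact hsub hy

/-- The branches after adding a leaf. -/
theorem reach_insert_subset (h : D.IsTree F U) {a : A} (hh : D.head a ∉ U) :
    D.reach (insert a F) x ⊆
      D.reach F x ∪ {z | z = D.head a ∧ D.tail a ∈ D.reach F x} := by
  refine reach_subset_of_closed (Or.inl mem_reach_self) ?_
  rintro b (rfl | hb) (h1 | ⟨h1, h2⟩)
  · exact Or.inr ⟨rfl, h1⟩
  · exact absurd h1 (D.loopless b)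
  · exact Or.inl (head_mem_reach hb h1)
  · exact absurd (h1 ▸ h.tail_mem b hb) hh

end IsTree

end RootedDigraph

/-! ### Extending pairs of trees -/

namespace RootedDigraph

open MultiDigraph

variable {V : Type u} {A : Type v} {D : RootedDigraph V A} {F F₀ F₁ F₂ : Set A}
  {U U₀ U₁ U₂ : Set V} {k N : ℕ} {a : A}

/-- If deleting `a` destroys root-connectivity, then `a` is the only arc entering some set. -/
theorem exists_tight_of_not_spans (hs : D.Spans F₁ᶜ) (ha : ¬ D.Spans (insert a F₁)ᶜ) :
    ∃ Z : Set V, D.root ∉ Z ∧ a ∈ D.entering Z ∧ ∀ c ∈ D.entering Z, c ∉ F₁ → c = a := by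
  rw [spans_iff] at hs ha
  push Not at ha
  obtain ⟨Z, hne, hr, hZ⟩ := ha
  have huniq : ∀ c ∈ D.entering Z, c ∉ F₁ → c = a := by
    intro c hc hcF
    by_contra hca
    exact hZ c (by simp [hca, hcF]) hc
  obtain ⟨c, hcF, hc⟩ := hs Z hne hr
  exact ⟨Z, hr, huniq c hc hcF ▸ hc, huniq⟩

/-- At least two arcs enter `Z`, and only one of them avoids `F₁`; an entering arc of `F₁` has its
head in the tree. -/
theorem exists_mem_tree_of_tight [Finite A] (h2 : D.IsRootConnected D.root 2)
    (ht : D.IsTree F₁ U₁) {Z : Set V} (hr : D.root ∉ Z) (ha : a ∈ D.entering Z)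
    (hZ : ∀ c ∈ D.entering Z, c ∉ F₁ → c = a) : ∃ u ∈ Z, u ∈ U₁ := by
  obtain ⟨b, hb, c, hc, hbc⟩ := h2.exists_ne ⟨_, ha.2⟩ hr
  by_cases hbF : b ∈ F₁
  · exact ⟨_, hb.2, ht.head_mem b hbF⟩
  · by_cases hcF : c ∈ F₁
    · exact ⟨_, hc.2, ht.head_mem c hcF⟩
    · exact absurd ((hZ b hb hbF).trans (hZ c hc hcF).symm) hbc

/-- A pair of arc-disjoint trees, neither of which blocks the rest of the digraph. -/
structure IsPair (D : RootedDigraph V A) (F₁ : Set A) (U₁ : Set V) (F₂ : Set A) (U₂ : Set V) :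
    Prop where
  left : D.IsTree F₁ U₁
  right : D.IsTree F₂ U₂
  disj : Disjoint F₁ F₂
  spans_left : D.Spans F₁ᶜ
  spans_right : D.Spans F₂ᶜ

theorem IsPair.symm (h : D.IsPair F₁ U₁ F₂ U₂) : D.IsPair F₂ U₂ F₁ U₁ :=
  ⟨h.right, h.left, h.disj.symm, h.spans_right, h.spans_left⟩

theorem IsPair.insert_arc (h : D.IsPair F₁ U₁ F₂ U₂) (ht : D.tail a ∈ U₁) (hh : D.head a ∉ U₁)
    (ha : a ∉ F₂) (hs : D.Spans (insert a F₁)ᶜ) :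
    D.IsPair (insert a F₁) (insert (D.head a) U₁) F₂ U₂ :=
  ⟨h.left.insert_arc ht hh, h.right, Set.disjoint_insert_left.2 ⟨ha, h.disj⟩, hs, h.spans_right⟩

/-- The augmentation step in Lovász's proof of Edmonds' branching theorem. -/
theorem IsPair.exists_arc [Finite V] [Finite A] (h2 : D.IsRootConnected D.root 2)
    (h : D.IsPair F₁ U₁ F₂ U₂) (hU : U₁ ≠ Set.univ) :
    ∃ a, D.tail a ∈ U₁ ∧ D.head a ∉ U₁ ∧ a ∉ F₂ ∧ D.Spans (insert a F₁)ᶜ := by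
  have htight : ∀ a, a ∉ F₂ → ¬ D.Spans (insert a F₁)ᶜ → ∃ Z : Set V, D.root ∉ Z ∧
      Disjoint Z U₂ ∧ a ∈ D.entering Z ∧ ∀ c ∈ D.entering Z, c ∉ F₁ → c = a := by
    intro a ha hs
    obtain ⟨Z, hr, haZ, hZ⟩ := exists_tight_of_not_spans h.spans_left hs
    refine ⟨Z, hr, ?_, haZ, hZ⟩
    rw [Set.disjoint_left]
    intro w hwZ hwU
    by_contra
    -- An arc of `F₂` entering `Z` would avoid `F₁` and so equal `a`, which is not in `F₂`. So `F₂`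
    -- cannot lead from the root into `Z`.
    have hcl : ∀ b ∈ F₂, D.tail b ∈ Zᶜ → D.head b ∈ Zᶜ := by
      intro b hb h1 h3
      exact ha (hZ b ⟨h1, h3⟩ (Set.disjoint_right.1 h.disj hb) ▸ hb)
    exact reach_subset_of_closed hr hcl (h.right.subset_reach hwU) hwZ
  let P : Set V → Prop := fun Z => D.root ∉ Z ∧ Disjoint Z U₂ ∧ (Z \ U₁).Nonempty ∧
    ∃ b, ∀ c ∈ D.entering Z, c ∉ F₁ → c = b
  by_cases hP : ∃ Z, P Z
  · obtain ⟨Z, ⟨hr, hZ2, hZ1, b, hb⟩, hmin⟩ := (Set.toFinite {Z | P Z}).exists_minimal hP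
    have hF : ∀ c ∈ D.entering (Z \ U₁), c ∉ F₁ :=
      fun c hc hcF => hc.2.2 (h.left.head_mem c hcF)
    -- Two arcs enter `Z \ U₁`, neither in `F₁`. If both started outside `Z`, both would equal `b`.
    obtain ⟨c, hc, hct⟩ : ∃ c ∈ D.entering (Z \ U₁), D.tail c ∈ Z := by
      obtain ⟨c, hc, d, hd, hcd⟩ := h2.exists_ne hZ1 (fun h => hr h.1)
      by_contra hno
      push Not at hno
      exact hcd ((hb c ⟨hno c hc, hc.2.1⟩ (hF c hc)).trans
        (hb d ⟨hno d hd, hd.2.1⟩ (hF d hd)).symm)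
    have hcU : D.tail c ∈ U₁ := by
      by_contra hcU
      exact hc.1 ⟨hct, hcU⟩
    have hc2 : c ∉ F₂ := fun hc' => Set.disjoint_left.1 hZ2 hc.2.1 (h.right.head_mem c hc')
    refine ⟨c, hcU, hc.2.2, hc2, ?_⟩
    by_contra hs
    obtain ⟨W, hrW, -, hcW, hW⟩ := htight c hc2 hs
    -- Uncrossing: the arc entering `Z ∪ W` must be `b`, since `c` starts in `Z`. Thus `b` starts
    -- outside `W`, which leaves `c` as the only arc outside `F₁` that can enter `Z ∩ W`. As the
    -- tail of `c` is in `Z` but not in `W`, this contradicts minimality.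
    obtain ⟨d, hdF, hdt, hdh⟩ := spans_iff.1 h.spans_left (Z ∪ W) ⟨_, Or.inr hcW.2⟩
      (by simp [hr, hrW])
    have hdZ : D.tail d ∉ Z := fun h => hdt (Or.inl h)
    have hdW : D.tail d ∉ W := fun h => hdt (Or.inr h)
    have hdb : d = b := by
      rcases hdh with hdh | hdh
      · exact hb d ⟨hdZ, hdh⟩ hdF
      · exact absurd (hW d ⟨hdW, hdh⟩ hdF ▸ hct) hdZ
    have hPW : P (Z ∩ W) := by
      refine ⟨fun h => hr h.1, hZ2.mono_left Set.inter_subset_left,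
        ⟨D.head c, ⟨hc.2.1, hcW.2⟩, hc.2.2⟩, c, fun e he heF => ?_⟩
      by_cases heW : D.tail e ∈ W
      · have heb : e = b := hb e ⟨fun h => he.1 ⟨h, heW⟩, he.2.1⟩ heF
        exact absurd (heb.trans hdb.symm ▸ heW) hdW
      · exact hW e ⟨heW, he.2.2⟩ heF
    exact hcW.1 (hmin hPW Set.inter_subset_left hct).2
  -- With no candidate set, any arc outside `F₂` that leaves `U₁` works: its tight set would be a
  -- candidate.
  · obtain ⟨a, haF, hat, hah⟩ := spans_iff.1 h.spans_right U₁ᶜ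
      (Set.nonempty_compl.2 hU) (fun hc => hc h.left.root_mem)
    refine ⟨a, not_not.1 hat, hah, haF, ?_⟩
    by_contra hs
    obtain ⟨Z, hr, hZ2, haZ, hZ⟩ := htight a haF hs
    exact hP ⟨Z, hr, hZ2, ⟨_, haZ.2, hah⟩, a, hZ⟩

/-- A vertex with many out-neighbours can be used to add a leaf. -/
theorem IsTree.exists_arc_of_outNeighbors [Finite V] [Finite A] (h2 : D.IsRootConnected D.root 2)
    (h : D.IsTree F₁ U₁) (hs : D.Spans F₁ᶜ) (hF₂ : ∀ a ∈ F₂, D.head a ∈ U₂) {x : V}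
    (hlarge : U₁.ncard + U₂.ncard + (U₁ \ {D.root}).ncard < (D.outNeighbors x).ncard) :
    ∃ a, D.tail a = x ∧ D.head a ∉ U₁ ∧ a ∉ F₂ ∧ D.Spans (insert a F₁)ᶜ := by
  by_contra hno
  push Not at hno
  have hchoice : ∀ y ∈ D.outNeighbors x \ (U₁ ∪ U₂), ∃ (a : A) (Z : Set V) (u : V),
      D.head a = y ∧ D.tail a = x ∧ a ∉ F₁ ∧ D.root ∉ Z ∧ a ∈ D.entering Z ∧
      (∀ c ∈ D.entering Z, c ∉ F₁ → c = a) ∧ u ∈ Z ∧ u ∈ U₁ := by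
    rintro y ⟨⟨a, ha, rfl⟩, hy⟩
    simp only [Set.mem_union, not_or] at hy
    obtain ⟨Z, hr, haZ, hZ⟩ := exists_tight_of_not_spans hs
      (hno a ha hy.1 fun haF => hy.2 (hF₂ a haF))
    obtain ⟨u, huZ, hu⟩ := exists_mem_tree_of_tight h2 h hr haZ hZ
    exact ⟨a, Z, u, rfl, ha, fun haF => hy.1 (h.head_mem a haF), hr, haZ, hZ, huZ, hu⟩
  obtain ⟨-, a₀, -⟩ := Set.nonempty_of_ncard_ne_zero (Nat.ne_zero_of_lt hlarge)
  have : Nonempty A := ⟨a₀⟩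
  choose! f Z u hh ht hF hr hent huniq huZ huU using hchoice
  -- Each blocked out-neighbour is charged to a non-root tree vertex in its tight set; the charge is
  -- injective because the tight sets are disjoint.
  have hle : (D.outNeighbors x \ (U₁ ∪ U₂)).ncard ≤ (U₁ \ {D.root}).ncard := by
    refine Set.ncard_le_ncard_of_injOn u ?_ ?_
    · intro y hy
      exact ⟨huU y hy, fun hc => hr y hy (hc ▸ huZ y hy)⟩
    · intro y hy y' hy' huu
      by_contra hne
      have hne' : f y ≠ f y' := fun hc => hne (by rw [← hh y hy, hc, hh y' hy'])
      -- The arc `c` enters at least one of the two sets, hence is its unique arc and starts at `x`.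
      -- Since `x` is outside both sets, `c` enters both and equals both blocked arcs.
      obtain ⟨c, hcF, hct, hch⟩ := spans_iff.1 hs (Z y ∩ Z y') ⟨u y, huZ y hy, huu ▸ huZ y' hy'⟩
        (fun hc => hr y hy hc.1)
      have hxy : x ∉ Z y := ht y hy ▸ (hent y hy).1
      have hxy' : x ∉ Z y' := ht y' hy' ▸ (hent y' hy').1
      have htail : D.tail c = x := by
        by_cases hcZ : D.tail c ∈ Z y
        · rw [huniq y' hy' c ⟨fun hc => hct ⟨hcZ, hc⟩, hch.2⟩ hcF, ht y' hy']
        · rw [huniq y hy c ⟨hcZ, hch.1⟩ hcF, ht y hy]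
      exact hne' ((huniq y hy c ⟨htail ▸ hxy, hch.1⟩ hcF).symm.trans
        (huniq y' hy' c ⟨htail ▸ hxy', hch.2⟩ hcF))
  have h3 := Set.ncard_le_ncard_sdiff_add_ncard (D.outNeighbors x) (U₁ ∪ U₂)
  have h4 := Set.ncard_union_le U₁ U₂
  omega

/-! ### The greedy procedure -/

/-- The arc `a` may be added to the tree `(F, U)`: it extends the tree, avoids `F₂`, does not
destroy root-connectivity, and creates no branch with more than `N - k` vertices. -/
structure IsAdmissible (D : RootedDigraph V A) (F : Set A) (U : Set V) (F₂ : Set A) (k N : ℕ)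
    (a : A) : Prop where
  tail_mem : D.tail a ∈ U
  head_notMem : D.head a ∉ U
  notMem : a ∉ F₂
  spans : D.Spans (insert a F)ᶜ
  branch_le : ∀ v, v ≠ D.root → (D.reach (insert a F) v).ncard + k ≤ N

/-- The property `I` is preserved by adding admissible arcs, and guarantees that there is one as
long as there are fewer than `N` vertices. -/
structure IsGreedy (D : RootedDigraph V A) (F₂ : Set A) (k N : ℕ) (I : Set A → Set V → Prop) :
    Prop where
  exists_arc : ∀ F U, I F U → U.ncard < N → ∃ a, D.IsAdmissible F U F₂ k N a
  insert_arc : ∀ F U a, I F U → U.ncard < N → D.IsAdmissible F U F₂ k N a →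
    I (insert a F) (insert (D.head a) U)
  head_mem : ∀ F U, I F U → ∀ a ∈ F, D.head a ∈ U

theorem IsGreedy.exists_final [Finite V] {I : Set A → Set V → Prop} (h : D.IsGreedy F₂ k N I)
    (hI : I F U) : ∃ F' U', I F' U' ∧ N ≤ U'.ncard := by
  induction hn : N - U.ncard generalizing F U with
  | zero => exact ⟨F, U, hI, by omega⟩
  | succ n ih =>
    obtain ⟨a, ha⟩ := h.exists_arc F U hI (by omega)
    refine ih (h.insert_arc F U a hI (by omega) ha) ?_
    rw [Set.ncard_insert_of_notMem ha.head_notMem]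
    omega

theorem IsTree.ncard_reach_insert_le [Finite V] (h : D.IsTree F U) (hh : D.head a ∉ U) (v : V) :
    (D.reach (insert a F) v).ncard ≤ (D.reach F v).ncard + 1 := by
  refine (Set.ncard_le_ncard (h.reach_insert_subset hh)).trans ?_
  refine (Set.ncard_union_le _ _).trans (Nat.add_le_add_left ?_ _)
  exact (Set.ncard_le_ncard (t := {D.head a}) fun z hz => hz.1).trans (Set.ncard_singleton _).le

theorem IsTree.ncard_reach_insert_of_notMem [Finite V] (h : D.IsTree F U) (ht : D.tail a ∈ U)
    (hh : D.head a ∉ U) {v : V} (hv : v ∉ U) : (D.reach (insert a F) v).ncard = 1 := by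
  have : D.reach (insert a F) v = {v} := by
    refine Set.Subset.antisymm ?_ (Set.singleton_subset_iff.2 mem_reach_self)
    refine (h.reach_insert_subset hh).trans ?_
    rw [h.reach_eq_singleton hv]
    rintro z (hz | ⟨-, hz⟩)
    · exact hz
    · exact absurd (show D.tail a = v from hz) (fun hc => hv (hc ▸ ht))
  rw [this, Set.ncard_singleton]

theorem IsTree.ncard_reach_insert_of_tail_notMem [Finite V] (h : D.IsTree F U) (hh : D.head a ∉ U)
    {v : V} (hv : D.tail a ∉ D.reach F v) :
    (D.reach (insert a F) v).ncard ≤ (D.reach F v).ncard := by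
  refine Set.ncard_le_ncard ((h.reach_insert_subset hh).trans ?_)
  rintro z (hz | ⟨-, hz⟩)
  · exact hz
  · exact absurd hz hv

/-! ### Enlarging a kernel to `2k-1` vertices -/

/-- A tree, together with numbers of leaves that may be hung from its large vertices so as to get
a tree with `2k-1` vertices that is `k`-safe. -/
def IsKernelTree (D : RootedDigraph V A) (k : ℕ) (F : Set A) (U : Set V) :
    Prop :=
  D.IsTree F U ∧ ∃ (t : ℕ) (f : Fin t → V), U.ncard + t = 2 * k - 1 ∧
    (∀ i, f i ∈ U ∧ D.IsLarge k (f i)) ∧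
    ∀ v ∈ U, v ≠ D.root → (D.reach F v).ncard + {i | f i ∈ D.reach F v}.ncard + k ≤ 2 * k - 1

theorem IsCompactKernel.isKernelTree [Finite V] [Finite A] {X : D.Sub} (hk : 1 ≤ k)
    (hX : D.IsCompactKernel k X) : D.IsKernelTree k X.arcs X.verts := by
  obtain ⟨hr, hcard, harb, -, f, hf, hsafe⟩ := hX
  refine ⟨(isTree_iff_isArborescence hr).1 harb, _, fun i => (f i).1, ?_,
    fun i => ⟨(f i).2, hf i⟩, ?_⟩
  · have := Set.ncard_sdiff_singleton_add_one hr (Set.toFinite X.verts)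
    omega
  · intro v hv hvr
    have h1 := hsafe.2 (Sum.inl ⟨v, hv⟩) fun hc => hvr (congrArg Subtype.val (Sum.inl.inj hc))
    have hset : {i | f i ∈ X.toDigraph.branch ⟨v, hv⟩} = {i | (f i).1 ∈ D.reach X.arcs v} := by
      ext i
      rw [Set.mem_ofPred_eq, Set.mem_ofPred_eq, ← X.image_branch ⟨v, hv⟩]
      exact (Function.Injective.mem_set_image Subtype.val_injective).symm
    rw [attachLeaves_ncard_branch, X.ncard_branch, hset] at h1
    rw [Nat.card_sum, Nat.card_coe_set_eq, Nat.card_fin] at h1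
    have := Set.ncard_sdiff_singleton_add_one hr (Set.toFinite X.verts)
    dsimp only at h1 ⊢
    omega

/-- As long as there are fewer than `2k-1` vertices, a leaf can be hung from a large vertex. -/
theorem IsKernelTree.exists_large [Finite V] (h₀ : D.IsKernelTree k F₀ U₀) (h : D.IsTree F U)
    (hF : F₀ ⊆ F) (hU : U₀ ⊆ U)
    (hb : ∀ v ∈ U, v ≠ D.root → (D.reach F v).ncard + k ≤ 2 * k - 1) (hcard : U.ncard < 2 * k - 1) :
    ∃ x ∈ U₀, D.IsLarge k x ∧
      ∀ v, v ≠ D.root → x ∈ D.reach F v → (D.reach F v).ncard + 1 + k ≤ 2 * k - 1 := by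
  classical
  have := Fintype.ofFinite V
  obtain ⟨h₀, t, f, ht, hf, hft⟩ := h₀
  by_contra hno
  push Not at hno
  -- Otherwise every slot `f i` lies in a saturated branch, one with exactly `k-1` vertices. Its top
  -- is an ancestor of `f i`, hence a vertex of the kernel.
  have hchoice : ∀ i, ∃ v ∈ U₀, v ≠ D.root ∧ f i ∈ D.reach F v ∧
      (D.reach F v).ncard + k = 2 * k - 1 := by
    intro i
    obtain ⟨v, hvr, hiv, hlt⟩ := hno (f i) (hf i).1 (hf i).2
    have hv := h₀.mem_of_mem_reach h hF hiv (hf i).1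
    have := hb v (hU hv) hvr
    exact ⟨v, hv, hvr, hiv, by omega⟩
  choose v hvU hvr hfv hvc using hchoice
  let R : Fin t → Set V := fun i => D.reach F (v i)
  -- Branches that meet are nested, and saturated branches all have the same size.
  have hdisj : ∀ i j, R i ≠ R j → Disjoint (R i) (R j) := by
    intro i j hij
    rw [Set.disjoint_left]
    intro z hzi hzj
    refine hij ?_
    rcases h.total hzi hzj with hc | hc
    · refine Set.eq_of_subset_of_ncard_le (reach_subset_reach hc) ?_
      have h1 := hvc i
      have h2 := hvc j
      change (D.reach F (v j)).ncard ≤ (D.reach F (v i)).ncard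
      omega
    · refine (Set.eq_of_subset_of_ncard_le (reach_subset_reach hc) ?_).symm
      have h1 := hvc i
      have h2 := hvc j
      change (D.reach F (v i)).ncard ≤ (D.reach F (v j)).ncard
      omega
  let G : Set V → Finset V := fun S => Finset.univ.filter (· ∈ S \ U₀)
  -- By `hft`, kernel vertices and slots in a saturated branch together number at most its size. So
  -- its slots are at most as many as the vertices already added there.
  have hfiber : ∀ i, (Finset.univ.filter fun j => R j = R i).card ≤ (G (R i)).card := by
    intro i
    have h1 : (Finset.univ.filter fun j => R j = R i).card ≤
        {j | f j ∈ D.reach F₀ (v i)}.ncard := by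
      rw [← Set.ncard_coe_finset]
      refine Set.ncard_le_ncard fun j hj => ?_
      have hj : R j = R i := by simpa using hj
      rw [Set.mem_ofPred_eq, ← h₀.reach_inter h hF (hvU i)]
      exact ⟨by change f j ∈ R i; rw [← hj]; exact hfv j, (hf j).1⟩
    have h2 := hft (v i) (hvU i) (hvr i)
    have h3 := hvc i
    have h4 := Set.ncard_inter_add_ncard_sdiff_eq_ncard (D.reach F (v i)) U₀
    rw [h₀.reach_inter h hF (hvU i)] at h4
    have h5 : (G (R i)).card = (D.reach F (v i) \ U₀).ncard := by
      rw [← Set.ncard_coe_finset]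
      congr 1
      ext z
      simp [G, R]
    omega
  -- Summing over the distinct saturated branches shows that at least `t` vertices have been added,
  -- so `U` already has `2k-1` vertices.
  have hle : t ≤ (U \ U₀).ncard := by
    calc t = (Finset.univ : Finset (Fin t)).card := by simp
      _ = ∑ S ∈ Finset.univ.image R, (Finset.univ.filter fun j => R j = S).card :=
        Finset.card_eq_sum_card_image R _
      _ ≤ ∑ S ∈ Finset.univ.image R, (G S).card := by
        refine Finset.sum_le_sum fun S hS => ?_
        obtain ⟨i, -, rfl⟩ := Finset.mem_image.1 hS
        exact hfiber i
      _ = ((Finset.univ.image R).biUnion G).card := by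
        refine (Finset.card_biUnion ?_).symm
        intro S hS S' hS' hne
        obtain ⟨i, -, rfl⟩ := Finset.mem_image.1 hS
        obtain ⟨j, -, rfl⟩ := Finset.mem_image.1 hS'
        refine Finset.disjoint_left.2 ?_
        intro z hz hz'
        simp only [G, Finset.mem_filter] at hz hz'
        exact Set.disjoint_left.1 (hdisj i j hne) hz.2.1 hz'.2.1
      _ ≤ (U \ U₀).ncard := by
        rw [← Set.ncard_coe_finset]
        refine Set.ncard_le_ncard fun z hz => ?_
        simp only [Finset.coe_biUnion, Set.mem_iUnion] at hz
        obtain ⟨S, hS, hz⟩ := hz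
        obtain ⟨i, -, rfl⟩ := Finset.mem_image.1 hS
        have hz : z ∈ D.reach F (v i) \ U₀ := by simpa [G, R] using hz
        exact ⟨h.reach_subset (hU (hvU i)) hz.1, hz.2⟩
  have := Set.ncard_sdiff_add_ncard_of_subset hU
  omega

/-- The property that the greedy procedure maintains while it enlarges the kernel `(F₀, U₀)` to a
safe tree with `2k-1` vertices. -/
def KernelPhase (D : RootedDigraph V A) (k : ℕ) (F₀ : Set A) (U₀ : Set V) (F₂ : Set A)
    (U₂ : Set V) (F : Set A) (U : Set V) : Prop :=
  D.IsPair F U F₂ U₂ ∧ F₀ ⊆ F ∧ U₀ ⊆ U ∧ U.ncard ≤ 2 * k - 1 ∧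
    ∀ v ∈ U, v ≠ D.root → (D.reach F v).ncard + k ≤ 2 * k - 1

theorem KernelPhase.isGreedy [Finite V] [Finite A] (h2 : D.IsRootConnected D.root 2)
    (h₀ : D.IsKernelTree k F₀ U₀) (hU₂ : U₂.ncard ≤ 2 * k - 1) :
    D.IsGreedy F₂ k (2 * k - 1) (D.KernelPhase k F₀ U₀ F₂ U₂) := by
  constructor
  · rintro F U ⟨hp, hF, hU, -, hb⟩ hlt
    obtain ⟨x, hx, hlarge, hcap⟩ := h₀.exists_large hp.left hF hU hb hlt
    have h1 := Set.ncard_sdiff_singleton_add_one hp.left.root_mem (Set.toFinite U)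
    -- This is the origin of the bound `6k-5`: the three cardinalities are at most `2k-2`, `2k-1`
    -- and `2k-3`, with sum `6k-6`.
    obtain ⟨a, rfl, hh, ha, hs⟩ := hp.left.exists_arc_of_outNeighbors (x := x) h2 hp.spans_left
      hp.right.head_mem (by unfold IsLarge at hlarge; omega)
    refine ⟨a, hU hx, hh, ha, hs, fun v hv => ?_⟩
    by_cases hvU : v ∈ U
    · by_cases hxv : D.tail a ∈ D.reach F v
      · have := hp.left.ncard_reach_insert_le hh v
        have := hcap v hv hxv
        omega
      · have := hp.left.ncard_reach_insert_of_tail_notMem hh hxv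
        have := hb v hvU hv
        omega
    -- A one-vertex branch needs `k ≥ 2`, which follows from `1 ≤ |U| < 2k-1`.
    · rw [hp.left.ncard_reach_insert_of_notMem (hU hx) hh hvU]
      omega
  · rintro F U a ⟨hp, hF, hU, -, hb⟩ hlt ha
    refine ⟨hp.insert_arc ha.tail_mem ha.head_notMem ha.notMem ha.spans,
      hF.trans (Set.subset_insert _ _), hU.trans (Set.subset_insert _ _), ?_,
      fun v _ hv => ha.branch_le v hv⟩
    rw [Set.ncard_insert_of_notMem ha.head_notMem]
    omega
  · exact fun F U hI => hI.1.left.head_mem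

/-! ### Enlarging a safe tree to a spanning tree -/

/-- The property that the greedy procedure maintains while it enlarges a safe tree to a spanning
tree. -/
def SpanningPhase (D : RootedDigraph V A) (k : ℕ) (F₂ : Set A) (U₂ : Set V) (F : Set A)
    (U : Set V) : Prop :=
  D.IsPair F U F₂ U₂ ∧ k ≤ U.ncard ∧ ∀ v ∈ U, v ≠ D.root → (D.reach F v).ncard + k ≤ U.ncard

/-- A new leaf adds at most one to each old branch and exactly one to `U`. The leaf's own branch is
a single vertex, harmless because the invariant includes `k ≤ |U|`. -/
theorem SpanningPhase.isGreedy [Finite V] [Finite A] (h2 : D.IsRootConnected D.root 2) :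
    D.IsGreedy F₂ k (Nat.card V) (D.SpanningPhase k F₂ U₂) := by
  have key : ∀ (F : Set A) (U : Set V) (a : A), D.SpanningPhase k F₂ U₂ F U → D.tail a ∈ U →
      D.head a ∉ U → ∀ v, v ≠ D.root → (D.reach (insert a F) v).ncard + k ≤ U.ncard + 1 := by
    rintro F U a ⟨hp, hk, hb⟩ ht hh v hv
    by_cases hvU : v ∈ U
    · have := hp.left.ncard_reach_insert_le hh v
      have := hb v hvU hv
      omega
    · rw [hp.left.ncard_reach_insert_of_notMem ht hh hvU]
      omega
  constructor
  · intro F U hI hlt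
    obtain ⟨a, ht, hh, ha, hs⟩ := hI.1.exists_arc h2
      (fun hc => by rw [hc, Set.ncard_univ] at hlt; exact lt_irrefl _ hlt)
    exact ⟨a, ht, hh, ha, hs, fun v hv => (key F U a hI ht hh v hv).trans hlt⟩
  · intro F U a hI hlt ha
    refine ⟨hI.1.insert_arc ha.tail_mem ha.head_notMem ha.notMem ha.spans, ?_, ?_⟩
    · rw [Set.ncard_insert_of_notMem ha.head_notMem]
      exact hI.2.1.trans (Nat.le_succ _)
    · intro v _ hv
      rw [Set.ncard_insert_of_notMem ha.head_notMem]
      exact key F U a hI ha.tail_mem ha.head_notMem v hv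
  · exact fun F U hI => hI.1.left.head_mem

theorem KernelPhase.start [Finite V] (h₀ : D.IsKernelTree k F₀ U₀) (hp : D.IsPair F₀ U₀ F₂ U₂) :
    D.KernelPhase k F₀ U₀ F₂ U₂ F₀ U₀ := by
  obtain ⟨h, t, f, ht, -, hb⟩ := h₀
  exact ⟨hp, le_rfl, le_rfl, by omega, fun v hv hvr => by have := hb v hv hvr; omega⟩

/-- What remains of `KernelPhase` at its end. -/
def SafeTree (D : RootedDigraph V A) (k : ℕ) (F : Set A) (U : Set V) : Prop :=
  k ≤ U.ncard ∧ ∀ v ∈ U, v ≠ D.root → (D.reach F v).ncard + k ≤ U.ncard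

theorem KernelPhase.safeTree (h : D.KernelPhase k F₀ U₀ F₂ U₂ F U) (hU : 2 * k - 1 ≤ U.ncard)
    (hk : 1 ≤ k) : D.SafeTree k F U := by
  obtain ⟨-, -, -, -, hb⟩ := h
  exact ⟨by omega, fun v hv hvr => (hb v hv hvr).trans hU⟩

theorem SafeTree.isSafeSpanningArborescence [Finite V] [Finite A] (h : D.IsTree F U)
    (hs : D.SafeTree k F U) (hU : Nat.card V ≤ U.ncard) :
    D.IsSafeSpanningArborescence k h.toSub := by
  have huniv : U = Set.univ :=
    Set.eq_of_subset_of_ncard_le (Set.subset_univ U) (by rwa [Set.ncard_univ])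
  refine ⟨huniv, h.root_mem, (isTree_iff_isArborescence (X := h.toSub) h.root_mem).2 h, ?_⟩
  rintro ⟨v, hv⟩ hne
  rw [Subdigraph.ncard_branch, Nat.card_coe_set_eq]
  have := hs.2 v hv (fun hc => hne (Subtype.ext hc))
  change k ≤ U.ncard - (D.reach F v).ncard
  omega

theorem IsCompactKernelPair.isPair [Finite V] [Finite A] {X₁ X₂ : D.Sub} (hk : 1 ≤ k)
    (h : D.IsCompactKernelPair k X₁ X₂) : D.IsPair X₁.arcs X₁.verts X₂.arcs X₂.verts :=
  ⟨(h.1.isKernelTree hk).1, (h.2.1.isKernelTree hk).1, h.2.2.1,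
    deleteArcs_isRootConnected_iff.1 h.2.2.2.1, deleteArcs_isRootConnected_iff.1 h.2.2.2.2⟩

theorem IsPair.isSafePacking [Finite V] [Finite A] (h : D.IsPair F₁ U₁ F₂ U₂)
    (h₁ : D.SafeTree k F₁ U₁) (h₂ : D.SafeTree k F₂ U₂) (hU₁ : Nat.card V ≤ U₁.ncard)
    (hU₂ : Nat.card V ≤ U₂.ncard) : D.IsSafePacking k h.left.toSub h.right.toSub :=
  ⟨h₁.isSafeSpanningArborescence h.left hU₁, h₂.isSafeSpanningArborescence h.right hU₂, h.disj⟩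

/-- Four runs of the greedy procedure, abstractly. -/
theorem IsCompactKernelPair.exists_packing [Finite V] [Finite A] (hk : 1 ≤ k)
    (h2 : D.IsRootConnected D.root 2) {X₁ X₂ : D.Sub} (h : D.IsCompactKernelPair k X₁ X₂) :
    ∃ T₁ T₂ : D.Sub, D.IsSafePacking k T₁ T₂ := by
  have hk₁ := h.1.isKernelTree hk
  have hk₂ := h.2.1.isKernelTree hk
  have hX₂ : X₂.verts.ncard ≤ 2 * k - 1 := by
    obtain ⟨-, t, -, ht, -⟩ := hk₂
    omega
  obtain ⟨F₁, U₁, hI₁, hU₁⟩ :=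
    (KernelPhase.isGreedy h2 hk₁ hX₂).exists_final (KernelPhase.start hk₁ (h.isPair hk))
  obtain ⟨F₂, U₂, hI₂, hU₂⟩ :=
    (KernelPhase.isGreedy h2 hk₂ hI₁.2.2.2.1).exists_final (KernelPhase.start hk₂ hI₁.1.symm)
  obtain ⟨F₁', U₁', hI₁', hU₁'⟩ := (SpanningPhase.isGreedy h2).exists_final
    (show D.SpanningPhase k F₂ U₂ F₁ U₁ from ⟨hI₂.1.symm, hI₁.safeTree hU₁ hk⟩)
  obtain ⟨F₂', U₂', hI₂', hU₂'⟩ := (SpanningPhase.isGreedy h2).exists_final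
    (show D.SpanningPhase k F₁' U₁' F₂ U₂ from ⟨hI₁'.1.symm, hI₂.safeTree hU₂ hk⟩)
  exact ⟨_, _, hI₂'.1.symm.isSafePacking hI₁'.2 hI₂'.2 hU₁' hU₂'⟩

end RootedDigraph

/-! ### Kernels inside safe spanning arborescences -/

namespace RootedDigraph

open MultiDigraph

variable {V : Type u} {A : Type v} {D : RootedDigraph V A} {F : Set A} {U : Set V} {k : ℕ}

/-- A descendant with a smallest branch has no child, as a child's branch would be strictly smaller.
-/
theorem IsTree.exists_leaf [Finite V] (h : D.IsTree F U) (v : V) :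
    ∃ l ∈ D.reach F v, ∀ a ∈ F, D.tail a ≠ l := by
  obtain ⟨l, hl, hmin⟩ := Set.exists_min_image (D.reach F v) (fun w => (D.reach F w).ncard)
    (Set.toFinite _) ⟨v, mem_reach_self⟩
  refine ⟨l, hl, ?_⟩
  rintro a ha rfl
  refine absurd (hmin _ (head_mem_reach ha hl)) (not_le.2 (Set.ncard_lt_ncard ?_))
  exact ⟨reach_subset_reach (head_mem_reach ha mem_reach_self),
    fun hc => h.tail_notMem_reach_head ha (hc mem_reach_self)⟩

/-- A safe tree contains a safe tree with `2k-1` vertices. -/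
theorem IsTree.exists_safe_subtree [Finite V] (hk : 1 ≤ k) (h : D.IsTree F U)
    (hs : ∀ v ∈ U, v ≠ D.root → (D.reach F v).ncard + k ≤ U.ncard) (hU : 2 * k - 1 ≤ U.ncard) :
    ∃ F' ⊆ F, ∃ U', D.IsTree F' U' ∧ U'.ncard = 2 * k - 1 ∧
      ∀ v ∈ U', v ≠ D.root → (D.reach F' v).ncard + k ≤ 2 * k - 1 := by
  induction hn : U.ncard generalizing F U with
  | zero => omega
  | succ n ih =>
    rcases hU.eq_or_lt with heq | hlt
    · exact ⟨F, le_rfl, U, h, heq.symm, by rwa [heq]⟩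
    -- Call a branch tight if it has `|U| - k` vertices. The leaf is taken below a vertex with a
    -- tight branch whenever there is one.
    obtain ⟨v, hvU, hvr, hv⟩ : ∃ v ∈ U, v ≠ D.root ∧
        ∀ w ∈ U, w ≠ D.root → (D.reach F w).ncard + k = U.ncard →
          (D.reach F v).ncard + k = U.ncard := by
      by_cases ht : ∃ v ∈ U, v ≠ D.root ∧ (D.reach F v).ncard + k = U.ncard
      · obtain ⟨v, hvU, hvr, hv⟩ := ht
        exact ⟨v, hvU, hvr, fun _ _ _ _ => hv⟩
      · obtain ⟨v, hvU, hvr⟩ := Set.exists_ne_of_one_lt_ncard (show 1 < U.ncard by omega) D.root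
        exact ⟨v, hvU, hvr, fun w hw hwr hc => absurd ⟨w, hw, hwr, hc⟩ ht⟩
    obtain ⟨l, hl, hleaf⟩ := h.exists_leaf v
    have hlU : l ∈ U := h.reach_subset hvU hl
    have hlr : D.root ≠ l := by
      rintro rfl
      exact root_notMem_reach hvr hl
    have h' := h.restrict (W := U \ {l}) ⟨h.root_mem, hlr⟩ Set.sdiff_subset
      (fun a ha _ => ⟨h.tail_mem a ha, hleaf a ha⟩)
    have hcard : (U \ {l}).ncard + 1 = U.ncard :=
      Set.ncard_sdiff_singleton_add_one hlU (Set.toFinite U)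
    have hs' : ∀ w ∈ U \ {l}, w ≠ D.root →
        (D.reach {a ∈ F | D.head a ∈ U \ {l}} w).ncard + k ≤ (U \ {l}).ncard := by
      intro w hw hwr
      have hle : D.reach {a ∈ F | D.head a ∈ U \ {l}} w ⊆ D.reach F w \ {l} := fun z hz =>
        ⟨reach_mono (fun a ha => ha.1) w hz, (h'.reach_subset hw hz).2⟩
      have hle' := Set.ncard_le_ncard hle
      have hw' := hs w hw.1 hwr
      by_cases hlw : l ∈ D.reach F w
      · have := Set.ncard_sdiff_singleton_add_one hlw (Set.toFinite _)
        omega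
      · rw [Set.sdiff_singleton_eq_self hlw] at hle'
        -- A tight branch that does not lose the leaf would be disjoint from the tight branch of
        -- `v`. Both miss the root, so `2(|U| - k) ≤ |U| - 1`, contradicting `|U| > 2k-1`.
        by_contra hlt'
        have hwt : (D.reach F w).ncard + k = U.ncard := by omega
        have hvt := hv w hw.1 hwr hwt
        have hdisj : Disjoint (D.reach F v) (D.reach F w) := by
          rw [Set.disjoint_left]
          intro z hz hz'
          rcases h.total hz hz' with hc | hc
          · exact hlw (reach_trans hc hl)
          · have := Set.eq_of_subset_of_ncard_le (reach_subset_reach hc) (by omega)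
            exact hlw (this ▸ hl)
        have hun : D.reach F v ∪ D.reach F w ⊆ U \ {D.root} := by
          rintro z (hz | hz)
          · refine ⟨h.reach_subset hvU hz, ?_⟩
            rintro rfl
            exact root_notMem_reach hvr hz
          · refine ⟨h.reach_subset hw.1 hz, ?_⟩
            rintro rfl
            exact root_notMem_reach hwr hz
        have h1 := Set.ncard_le_ncard hun
        rw [Set.ncard_union_eq hdisj] at h1
        have h2 := Set.ncard_sdiff_singleton_add_one h.root_mem (Set.toFinite U)
        omega
    obtain ⟨F', hF', hrest⟩ := ih h' hs' (by omega) (by omega)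
    exact ⟨F', hF'.trans fun a ha => ha.1, hrest⟩

/-- Cutting a safe tree with `2k-1` vertices below its large vertices gives a compact kernel. -/
theorem IsTree.exists_kernel [Finite V] [Finite A] (hk : 1 ≤ k) (h : D.IsTree F U)
    (hU : U.ncard = 2 * k - 1)
    (hs : ∀ v ∈ U, v ≠ D.root → (D.reach F v).ncard + k ≤ 2 * k - 1) :
    ∃ X : D.Sub, X.arcs ⊆ F ∧ D.IsCompactKernel k X := by
  -- The vertices with no large proper ancestor.
  let W : Set V := {v ∈ U | ∀ u, D.IsLarge k u → v ∈ D.reach F u → v = u}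
  have hWU : W ⊆ U := fun v hv => hv.1
  have hrW : D.root ∈ W := by
    refine ⟨h.root_mem, fun u _ hu => ?_⟩
    by_contra hne
    exact root_notMem_reach (fun hc => hne hc.symm) hu
  have hT := h.restrict hrW hWU (by
    intro a ha hh
    refine ⟨h.tail_mem a ha, fun u hu hau => ?_⟩
    obtain rfl := hh.2 u hu (head_mem_reach ha hau)
    exact absurd hau (h.tail_notMem_reach_head ha))
  have habove : ∀ z ∈ U \ W, ∃ x ∈ W, D.IsLarge k x ∧ z ∈ D.reach F x := by
    rintro z ⟨hzU, hzW⟩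
    let S : Set V := {u | D.IsLarge k u ∧ z ∈ D.reach F u ∧ z ≠ u}
    have hS : S.Nonempty := by
      by_contra hS
      refine hzW ⟨hzU, fun u hu hzu => ?_⟩
      by_contra hne
      exact hS ⟨u, hu, hzu, hne⟩
    -- The large ancestor with the biggest branch is the topmost one, so it survives the cut.
    obtain ⟨x, ⟨hx, hzx, hne⟩, hmax⟩ :=
      Set.exists_max_image S (fun u => (D.reach F u).ncard) (Set.toFinite _) hS
    have hmemU : ∀ u, z ∈ D.reach F u → u ∈ U := fun u hu =>
      h.mem_of_mem_reach h le_rfl hu hzU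
    refine ⟨x, ⟨hmemU x hzx, fun u hu hxu => ?_⟩, hx, hzx⟩
    by_contra hxu'
    have hzu := reach_trans hxu hzx
    have hzne : z ≠ u := by
      rintro rfl
      exact hne (h.antisymm hzU hxu hzx)
    refine absurd (hmax u ⟨hu, hzu, hzne⟩) (not_le.2 (Set.ncard_lt_ncard ?_))
    refine ⟨reach_subset_reach hxu, fun hc => hxu' ?_⟩
    exact (h.antisymm (hmemU u hzu) hxu (hc mem_reach_self)).symm
  have hcardW := Set.ncard_sdiff_singleton_add_one hrW (Set.toFinite W)
  have hcardU := Set.ncard_sdiff_add_ncard_of_subset hWU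
  choose! g hgW hgL hgz using habove
  have hcard : Nat.card (U \ W : Set V) = 2 * k - 2 - (W \ {D.root}).ncard := by
    rw [Nat.card_coe_set_eq]
    omega
  let e : Fin (2 * k - 2 - (W \ {D.root}).ncard) ≃ (U \ W : Set V) :=
    (Finite.equivFinOfCardEq hcard).symm
  have harb := (isTree_iff_isArborescence (X := hT.toSub) hrW).2 hT
  refine ⟨hT.toSub, fun a ha => ha.1, hrW, ?_, harb, ?_,
    fun i => ⟨g (e i), hgW _ (e i).2⟩, fun i => hgL _ (e i).2, harb.attachLeaves _, ?_⟩
  · change (W \ {D.root}).ncard ≤ _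
    omega
  · rintro ⟨x, hx⟩ hlarge
    rw [isSink_iff]
    rintro ⟨a, ha, haW⟩ hax
    have hax' : D.tail a = x := congrArg Subtype.val hax
    subst hax'
    exact D.loopless a (haW.2 _ hlarge (head_mem_reach ha mem_reach_self)).symm
  · have htotal : Nat.card (hT.toSub.verts ⊕ Fin (2 * k - 2 - (W \ {D.root}).ncard)) =
        2 * k - 1 := by
      rw [Nat.card_sum, Nat.card_coe_set_eq, Nat.card_fin]
      change W.ncard + _ = _
      omega
    change ∀ x, _ → k ≤ Nat.card (hT.toSub.verts ⊕ Fin (2 * k - 2 - (W \ {D.root}).ncard)) - _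
    rw [htotal]
    rintro (⟨v, hv⟩ | i) hne
    · have hvr : v ≠ D.root := fun hc => hne (congrArg Sum.inl (Subtype.ext hc))
      rw [attachLeaves_ncard_branch, Subdigraph.ncard_branch]
      have hbr : ∀ w, w ∈ hT.toSub.toDigraph.branch ⟨v, hv⟩ → w.1 ∈ D.reach F v := by
        intro w hw
        have hw' := hT.toSub.image_branch ⟨v, hv⟩ ▸ Set.mem_image_of_mem Subtype.val hw
        exact reach_mono (fun a ha => ha.1) v hw'
      have h1 : (D.reach hT.toSub.arcs v).ncard = (D.reach F v ∩ W).ncard := by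
        rw [hT.reach_inter h (fun a ha => ha.1) hv]
        rfl
      -- A new leaf counted in the branch of `v` stands for a cut vertex that was already below `v`,
      -- so branches do not grow.
      have h2 : {i | (⟨g (e i), hgW _ (e i).2⟩ : W) ∈
          hT.toSub.toDigraph.branch ⟨v, hv⟩}.ncard ≤ (D.reach F v \ W).ncard := by
        refine Set.ncard_le_ncard_of_injOn (fun i => (e i).1) ?_ ?_
        · intro i hi
          have hi' := hbr _ hi
          exact ⟨reach_trans hi' (hgz _ (e i).2), (e i).2.2⟩
        · intro i _ j _ hij
          exact e.injective (Subtype.ext hij)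
      have h3 := Set.ncard_inter_add_ncard_sdiff_eq_ncard (D.reach F v) W
      have h4 := hs v hv.1 hvr
      have h5 := Nat.add_le_add h1.le h2
      refine Nat.le_sub_of_add_le' ?_
      calc _ ≤ (D.reach F v ∩ W).ncard + (D.reach F v \ W).ncard + k := Nat.add_le_add_right h5 k
        _ ≤ _ := by omega
    -- The existence of the index `i` forces `k ≥ 2`, which is what a one-vertex branch needs.
    · rw [attachLeaves_branch_inr, Set.ncard_singleton]
      have := i.2
      omega

theorem IsSafeSpanningArborescence.exists_kernel [Finite V] [Finite A] {T : D.Sub} (hk : 1 ≤ k)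
    (hV : 2 * k - 2 ≤ Nat.card {x : V // x ≠ D.root}) (hT : D.IsSafeSpanningArborescence k T) :
    ∃ X : D.Sub, X.arcs ⊆ T.arcs ∧ D.IsCompactKernel k X := by
  obtain ⟨huniv, hr, harb, hs⟩ := hT
  have ht := (isTree_iff_isArborescence hr).1 harb
  have hcard : Nat.card {x : V // x ≠ D.root} + 1 = T.verts.ncard := by
    rw [huniv, ← Set.ncard_sdiff_singleton_add_one (Set.mem_univ D.root), ← Set.compl_eq_univ_sdiff]
    rfl
  obtain ⟨F', hF', U', ht', hU', hs'⟩ := ht.exists_safe_subtree hk (by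
    intro v hv hvr
    have h1 := hs ⟨v, hv⟩ fun hc => hvr (congrArg Subtype.val hc)
    rw [Subdigraph.ncard_branch, Nat.card_coe_set_eq] at h1
    dsimp only at h1
    omega) (by omega)
  obtain ⟨X, hX, hX'⟩ := ht'.exists_kernel hk hU' hs'
  exact ⟨X, hX.trans hF', hX'⟩

theorem IsSafePacking.exists_kernelPair [Finite V] [Finite A] {T₁ T₂ : D.Sub} (hk : 1 ≤ k)
    (hV : 2 * k - 2 ≤ Nat.card {x : V // x ≠ D.root}) (h : D.IsSafePacking k T₁ T₂) :
    ∃ X₁ X₂ : D.Sub, D.IsCompactKernelPair k X₁ X₂ := by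
  obtain ⟨X₁, hX₁, hK₁⟩ := h.1.exists_kernel hk hV
  obtain ⟨X₂, hX₂, hK₂⟩ := h.2.1.exists_kernel hk hV
  have hspans : ∀ T : D.Sub, D.IsSafeSpanningArborescence k T → D.Spans T.arcs := by
    rintro T ⟨huniv, hr, harb, -⟩ y
    exact ((isTree_iff_isArborescence hr).1 harb).subset_reach (huniv ▸ Set.mem_univ y)
  refine ⟨X₁, X₂, hK₁, hK₂, h.2.2.mono hX₁ hX₂, deleteArcs_isRootConnected_iff.2 ?_,
    deleteArcs_isRootConnected_iff.2 ?_⟩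
  · exact spans_mono (Set.disjoint_right.1 (h.2.2.mono_left hX₁)) (hspans T₂ h.2.1)
  · exact spans_mono (Set.disjoint_left.1 (h.2.2.mono_right hX₂)) (hspans T₁ h.1)

end RootedDigraph

/-! ### Running times of programs -/

namespace RAM

/-- The program `P`, started in `s`, halts within `T` steps in a state satisfying `Q`. -/
def Runs (P : Prog) (s : State) (T : ℕ) (Q : State → Prop) : Prop :=
  ∃ s' t, Exec P s s' t ∧ t ≤ T ∧ Q s'

@[simp] theorem State.setVar_var (s : State) (x n y : ℕ) :
    (s.setVar x n).var y = if y = x then n else s.var y := by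
  simp [State.setVar, Function.update_apply]

@[simp] theorem State.setVar_arr (s : State) (x n : ℕ) : (s.setVar x n).arr = s.arr := rfl

@[simp] theorem State.setArr_var (s : State) (b i n : ℕ) : (s.setArr b i n).var = s.var := rfl

@[simp] theorem State.setArr_arr (s : State) (b i n c j : ℕ) :
    (s.setArr b i n).arr c j = if c = b ∧ j = i then n else s.arr c j := by
  by_cases hc : c = b
  · subst hc
    simp [State.setArr, Function.update_apply]
  · simp [State.setArr, hc]

theorem State.setArr_arr_of_ne (s : State) {b c : ℕ} (i n : ℕ) (h : c ≠ b) :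
    (s.setArr b i n).arr c = s.arr c := by
  simp [State.setArr, h]

/-- The registers that a program may change. -/
def Prog.vars : Prog → List ℕ
  | skip => []
  | set x _ => [x]
  | put _ _ _ => []
  | seq P Q => P.vars ++ Q.vars
  | ite _ P Q => P.vars ++ Q.vars
  | loop _ P => P.vars

/-- The arrays that a program may change. -/
def Prog.arrs : Prog → List ℕ
  | skip => []
  | set _ _ => []
  | put b _ _ => [b]
  | seq P Q => P.arrs ++ Q.arrs
  | ite _ P Q => P.arrs ++ Q.arrs
  | loop _ P => P.arrs

/-- The states `s` and `s'` agree outside the registers in `X` and the arrays in `B`. -/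
def Same (X B : List ℕ) (s s' : State) : Prop :=
  (∀ x ∉ X, s'.var x = s.var x) ∧ ∀ b ∉ B, s'.arr b = s.arr b

theorem Same.trans {X B X' B' : List ℕ} {s s' s'' : State} (h : Same X B s s')
    (h' : Same X' B' s' s'') : Same (X ++ X') (B ++ B') s s'' := by
  constructor
  · intro x hx
    rw [List.mem_append, not_or] at hx
    rw [h'.1 x hx.2, h.1 x hx.1]
  · intro b hb
    rw [List.mem_append, not_or] at hb
    rw [h'.2 b hb.2, h.2 b hb.1]

theorem Same.mono {X B X' B' : List ℕ} {s s' : State} (h : Same X B s s') (hX : X ⊆ X')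
    (hB : B ⊆ B') : Same X' B' s s' :=
  ⟨fun x hx => h.1 x fun hc => hx (hX hc), fun b hb => h.2 b fun hc => hb (hB hc)⟩

theorem same_setVar (s : State) (x n : ℕ) : Same [x] [] s (s.setVar x n) := by
  refine ⟨fun y hy => ?_, fun _ _ => rfl⟩
  rw [List.mem_singleton] at hy
  simp [hy]

theorem same_setArr (s : State) (b i n : ℕ) : Same [] [b] s (s.setArr b i n) := by
  refine ⟨fun _ _ => rfl, fun c hc => ?_⟩
  rw [List.mem_singleton] at hc
  exact s.setArr_arr_of_ne _ _ hc

/-- A syntactic frame rule: for a concrete program, `decide` settles which registers and arrays are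
untouched. -/
theorem Exec.same {P : Prog} {s s' : State} {t : ℕ} (h : Exec P s s' t) :
    Same P.vars P.arrs s s' := by
  induction h with
  | skip s => exact ⟨fun _ _ => rfl, fun _ _ => rfl⟩
  | set s x e => exact same_setVar s x _
  | put s b i e => exact same_setArr s b _ _
  | seq _ _ ih ih' => exact ih.trans ih'
  | ite_true _ _ ih => exact ih.mono (List.subset_append_left _ _) (List.subset_append_left _ _)
  | ite_false _ _ ih => exact ih.mono (List.subset_append_right _ _) (List.subset_append_right _ _)
  | loop_true _ _ _ ih ih' =>
    exact (ih.trans ih').mono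
      (List.append_subset_of_subset_of_subset (fun _ h => h) fun _ h => h)
      (List.append_subset_of_subset_of_subset (fun _ h => h) fun _ h => h)
  | loop_false _ => exact ⟨fun _ _ => rfl, fun _ _ => rfl⟩

namespace Runs

variable {P P' : Prog} {s : State} {T T' : ℕ} {Q Q' : State → Prop}

theorem mono (h : Runs P s T Q) (hT : T ≤ T') (hQ : ∀ s', Q s' → Q' s') : Runs P s T' Q' := by
  obtain ⟨s', t, he, ht, hq⟩ := h
  exact ⟨s', t, he, ht.trans hT, hQ s' hq⟩

theorem frame (h : Runs P s T Q) : Runs P s T fun s' => Q s' ∧ Same P.vars P.arrs s s' := by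
  obtain ⟨s', t, he, ht, hq⟩ := h
  exact ⟨s', t, he, ht, hq, he.same⟩

theorem skip (h : Q s) : Runs Prog.skip s 1 Q := ⟨s, 1, Exec.skip s, le_rfl, h⟩

theorem set {x : ℕ} {e : Expr} (h : Q (s.setVar x (e.eval s))) : Runs (Prog.set x e) s 1 Q :=
  ⟨_, 1, Exec.set s x e, le_rfl, h⟩

theorem put {b : ℕ} {i e : Expr} (h : Q (s.setArr b (i.eval s) (e.eval s))) :
    Runs (Prog.put b i e) s 1 Q :=
  ⟨_, 1, Exec.put s b i e, le_rfl, h⟩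

theorem seq {R : State → Prop} (h : Runs P s T R) (h' : ∀ s', R s' → Runs P' s' T' Q) :
    Runs (Prog.seq P P') s (T + T') Q := by
  obtain ⟨s', t, he, ht, hr⟩ := h
  obtain ⟨s'', t', he', ht', hq⟩ := h' s' hr
  exact ⟨s'', t + t', Exec.seq he he', Nat.add_le_add ht ht', hq⟩

theorem set_seq {x : ℕ} {e : Expr} (h : Runs P (s.setVar x (e.eval s)) T Q) :
    Runs (Prog.seq (Prog.set x e) P) s (1 + T) Q :=
  seq (set (Q := fun s' => s' = s.setVar x (e.eval s)) rfl) (by rintro _ rfl; exact h)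

theorem put_seq {b : ℕ} {i e : Expr} (h : Runs P (s.setArr b (i.eval s) (e.eval s)) T Q) :
    Runs (Prog.seq (Prog.put b i e) P) s (1 + T) Q :=
  seq (put (Q := fun s' => s' = s.setArr b (i.eval s) (e.eval s)) rfl) (by rintro _ rfl; exact h)

theorem ite {b : Test} (h : b.Holds s → Runs P s T Q) (h' : ¬ b.Holds s → Runs P' s T' Q) :
    Runs (Prog.ite b P P') s (T + T' + 1) Q := by
  by_cases hb : b.Holds s
  · obtain ⟨s', t, he, ht, hq⟩ := h hb
    exact ⟨s', t + 1, Exec.ite_true hb he, by omega, hq⟩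
  · obtain ⟨s', t, he, ht, hq⟩ := h' hb
    exact ⟨s', t + 1, Exec.ite_false hb he, by omega, hq⟩

/-- The variant `φ` bounds the number of iterations; each costs the body plus one test, and the
failing test costs one more step. -/
theorem loop {b : Test} (I : State → Prop) (φ : State → ℕ)
    (body : ∀ s, I s → b.Holds s → Runs P s T fun s' => I s' ∧ φ s' < φ s) (h : I s) :
    Runs (Prog.loop b P) s (φ s * (T + 1) + 1) fun s' => I s' ∧ ¬ b.Holds s' := by
  induction hn : φ s using Nat.strong_induction_on generalizing s with
  | _ n ih =>
    by_cases hb : b.Holds s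
    · obtain ⟨s', t, he, ht, hI, hlt⟩ := body s h hb
      obtain ⟨s'', t', he', ht', hq⟩ := ih (φ s') (hn ▸ hlt) hI rfl
      refine ⟨s'', t + t' + 1, Exec.loop_true hb he he', ?_, hq⟩
      have : (φ s' + 1) * (T + 1) ≤ n * (T + 1) := Nat.mul_le_mul_right _ (hn ▸ hlt)
      rw [Nat.add_mul] at this
      omega
    · exact ⟨s, 1, Exec.loop_false hb, by omega, h, hb⟩

end Runs

/-- `for x in 0, …, e-1 do P`. -/
def forRange (x : ℕ) (e : Expr) (P : Prog) : Prog :=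
  Prog.seq (Prog.set x (Expr.const 0))
    (Prog.loop (Test.lt (Expr.var x) e)
      (Prog.seq P (Prog.set x (Expr.add (Expr.var x) (Expr.const 1)))))

theorem Runs.forRange {x : ℕ} {e : Expr} {P : Prog} {s : State} {T : ℕ} (N : ℕ)
    (I : ℕ → State → Prop) (h0 : I 0 (s.setVar x 0)) (hN : ∀ i s, I i s → e.eval s = N)
    (body : ∀ i < N, ∀ s, s.var x = i → I i s →
      Runs P s T fun s' => s'.var x = i ∧ I (i + 1) (s'.setVar x (i + 1))) :
    Runs (forRange x e P) s (N * (T + 2) + 2) (I N) := by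
  have hloop := Runs.loop (P := Prog.seq P (Prog.set x (Expr.add (Expr.var x) (Expr.const 1))))
    (b := Test.lt (Expr.var x) e) (T := T + 1) (s := s.setVar x 0)
    (fun s' => s'.var x ≤ N ∧ I (s'.var x) s') (fun s' => N - s'.var x) ?_ ?_
  · refine (Runs.set_seq hloop).mono ?_ ?_
    · simp [Nat.add_assoc]
      omega
    · rintro s' ⟨⟨h1, h2⟩, h3⟩
      have h4 := hN _ _ h2
      have h5 : ¬ s'.var x < e.eval s' := h3
      have h6 : s'.var x = N := by omega
      exact h6 ▸ h2
  · rintro s' ⟨h1, h2⟩ hlt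
    have hlt' : s'.var x < e.eval s' := hlt
    rw [hN _ _ h2] at hlt'
    refine Runs.seq (body _ hlt' s' rfl h2) fun s'' hs'' => Runs.set ?_
    have hx : s''.var x = s'.var x := hs''.1
    simp only [Expr.eval, hx, State.setVar_var, if_true]
    exact ⟨⟨hlt', hs''.2⟩, by omega⟩
  · simpa using h0

/-! ### Memory holding sets of vertices and arcs -/

open Classical in
theorem indicator_apply {n : ℕ} (S : Set (Fin n)) (i : Fin n) :
    indicator S i = if i ∈ S then 1 else 0 := by
  simp [indicator, tabulate]

theorem indicator_eq_one {n : ℕ} {S : Set (Fin n)} {i : Fin n} : indicator S i = 1 ↔ i ∈ S := by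
  classical
  rw [indicator_apply]
  split_ifs with h <;> simp [h]

theorem indicator_eq_zero {n : ℕ} {S : Set (Fin n)} {i : Fin n} : indicator S i = 0 ↔ i ∉ S := by
  classical
  rw [indicator_apply]
  split_ifs with h <;> simp [h]

theorem sum_indicator {n : ℕ} (S : Set (Fin n)) :
    ∑ i ∈ Finset.range n, indicator S i = S.ncard := by
  classical
  rw [Finset.sum_range]
  simp only [indicator_apply, Finset.sum_boole]
  rw [← Set.ncard_coe_finset]
  simp

/-- The array `f` starts with the characteristic vector of `S`. -/
def Holds {n : ℕ} (f : ℕ → ℕ) (S : Set (Fin n)) : Prop := ∀ i : Fin n, f i = indicator S i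

theorem Holds.insert {n : ℕ} {s : State} {b : ℕ} {S : Set (Fin n)} (h : Holds (s.arr b) S)
    (i : Fin n) : Holds ((s.setArr b i 1).arr b) (insert i S) := by
  classical
  intro j
  have := h j
  rw [indicator_apply] at this ⊢
  by_cases hj : j = i
  · simp [hj]
  · simp [this, hj, Fin.val_inj]

theorem Holds.sdiff {n : ℕ} {s : State} {b : ℕ} {S : Set (Fin n)} (h : Holds (s.arr b) S)
    (i : Fin n) : Holds ((s.setArr b i 0).arr b) (S \ {i}) := by
  classical
  intro j
  have := h j
  rw [indicator_apply] at this ⊢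
  by_cases hj : j = i
  · simp [hj]
  · simp [this, hj, Fin.val_inj]

/-- Counts the vertices in array `b`. -/
def count (b : ℕ) : Prog :=
  Prog.seq (Prog.set 12 (Expr.const 0))
    (forRange 10 (Expr.var 0) (Prog.set 12 (Expr.add (Expr.var 12) (Expr.get b (Expr.var 10)))))

theorem count_runs {n b : ℕ} {s : State} {S : Set (Fin n)} (hn : s.var 0 = n)
    (hS : Holds (s.arr b) S) : Runs (count b) s (3 * n + 3) fun s' => s'.var 12 = S.ncard := by
  refine (Runs.set_seq (Runs.forRange n
    (fun i s' => s'.var 0 = n ∧ s'.arr b = s.arr b ∧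
      s'.var 12 = ∑ j ∈ Finset.range i, s.arr b j)
    (T := 1) ?_ ?_ ?_)).mono ?_ ?_
  · simp [hn, Expr.eval]
  · rintro i s' ⟨h, -⟩
    exact h
  · rintro i hi s' hx ⟨h0, h1, h2⟩
    refine Runs.set ?_
    simp [Expr.eval, hx, h0, h1, h2, Finset.sum_range_succ]
  · omega
  · rintro s' ⟨-, -, h⟩
    rw [h, ← sum_indicator]
    exact Finset.sum_congr rfl fun i hi => hS ⟨i, Finset.mem_range.1 hi⟩

end RAM

namespace RAM

open MultiDigraph RootedDigraph

variable {n m : ℕ}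

/-! ### Reachability -/

/-- Marks in array `6` the vertices reachable from the vertex in register `8` by arcs whose entry
in array `2` equals register `9`. -/
def search : Prog :=
  Prog.seq (forRange 10 (Expr.var 0) (Prog.put 6 (Expr.var 10) (Expr.const 0)))
    (Prog.seq (Prog.put 6 (Expr.var 8) (Expr.const 1))
      (forRange 10 (Expr.var 0) (forRange 11 (Expr.var 1)
        (Prog.ite (Test.and (Test.eq (Expr.get 2 (Expr.var 11)) (Expr.var 9))
            (Test.eq (Expr.get 6 (Expr.get 0 (Expr.var 11))) (Expr.const 1)))
          (Prog.put 6 (Expr.get 1 (Expr.var 11)) (Expr.const 1)) Prog.skip))))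

/-- The memory relevant for searching. -/
structure SearchInput (D : MultiDigraph (Fin n) (Fin m)) (G : Set (Fin m)) (s : State) :
    Prop where
  order : s.var 0 = n
  size : s.var 1 = m
  tail : ∀ a : Fin m, s.arr 0 a = D.tail a
  head : ∀ a : Fin m, s.arr 1 a = D.head a
  mem : ∀ a : Fin m, s.arr 2 a = s.var 9 ↔ a ∈ G

theorem SearchInput.of_same {D : MultiDigraph (Fin n) (Fin m)} {G : Set (Fin m)} {s s' : State}
    (h : SearchInput D G s) {X B : List ℕ} (hs : Same X B s s')
    (hX : 0 ∉ X ∧ 1 ∉ X ∧ 9 ∉ X) (hB : 0 ∉ B ∧ 1 ∉ B ∧ 2 ∉ B) : SearchInput D G s' := by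
  refine ⟨?_, ?_, ?_, ?_, ?_⟩
  · rw [hs.1 0 hX.1, h.order]
  · rw [hs.1 1 hX.2.1, h.size]
  · rw [hs.2 0 hB.1]
    exact h.tail
  · rw [hs.2 1 hB.2.1]
    exact h.head
  · rw [hs.2 2 hB.2.2, hs.1 9 hX.2.2]
    exact h.mem

/-- Marks set earlier in the round may be used later in it, so only two bounds are tracked:
everything marked is reachable, and every out-neighbour of the initial marks gets marked. -/
theorem search_round_runs {D : MultiDigraph (Fin n) (Fin m)} {G : Set (Fin m)} {s : State}
    (h : SearchInput D G s) {S : Set (Fin n)} (hS : Holds (s.arr 6) S) {v : Fin n}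
    (hSv : S ⊆ D.reach G v) :
    Runs (forRange 11 (Expr.var 1)
      (Prog.ite (Test.and (Test.eq (Expr.get 2 (Expr.var 11)) (Expr.var 9))
          (Test.eq (Expr.get 6 (Expr.get 0 (Expr.var 11))) (Expr.const 1)))
        (Prog.put 6 (Expr.get 1 (Expr.var 11)) (Expr.const 1)) Prog.skip)) s (5 * m + 2)
      fun s' => ∃ S', Holds (s'.arr 6) S' ∧ S ⊆ S' ∧ S' ⊆ D.reach G v ∧
        ∀ a ∈ G, D.tail a ∈ S → D.head a ∈ S' := by
  refine (Runs.forRange m (fun i s' => SearchInput D G s' ∧ ∃ S', Holds (s'.arr 6) S' ∧ S ⊆ S' ∧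
    S' ⊆ D.reach G v ∧ ∀ a ∈ G, a.1 < i → D.tail a ∈ S → D.head a ∈ S') (T := 3) ?_ ?_ ?_).mono
    ?_ ?_
  · refine ⟨h.of_same (same_setVar s 11 _) (by decide) (by decide), S, hS, le_rfl,
      hSv, ?_⟩
    rintro a - ha
    exact absurd ha (Nat.not_lt_zero _)
  · rintro i s' ⟨h', -⟩
    exact h'.size
  · rintro i hi s' hx ⟨h', S', hS', hSS', hSv', hstep⟩
    let a : Fin m := ⟨i, hi⟩
    have htest : (Test.and (Test.eq (Expr.get 2 (Expr.var 11)) (Expr.var 9))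
        (Test.eq (Expr.get 6 (Expr.get 0 (Expr.var 11))) (Expr.const 1))).Holds s' ↔
        a ∈ G ∧ D.tail a ∈ S' := by
      have h1 := h'.mem a
      have h2 := h'.tail a
      have h3 := hS' (D.tail a)
      have h4 := @indicator_eq_one n S' (D.tail a)
      simp only [a] at h1 h2 h3 h4
      simp only [Test.Holds, Expr.eval, hx, h2, h3, a]
      rw [h1, h4]
    refine (Runs.ite (fun hb => Runs.put ?_) fun hb => Runs.skip ?_).mono (le_refl (1 + 1 + 1))
      fun _ => id
    · rw [htest] at hb
      refine ⟨by simpa using hx, ?_, ?_⟩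
      · exact (h'.of_same (same_setArr s' 6 _ _) (by decide) (by decide)).of_same
          (same_setVar _ 11 _) (by decide) (by decide)
      · have h2 := h'.head a
        simp only [a] at h2
        refine ⟨insert (D.head a) S', ?_, hSS'.trans (Set.subset_insert _ _), ?_, ?_⟩
        · simp only [Expr.eval, hx, h2, State.setVar_arr]
          exact hS'.insert (D.head a)
        · exact Set.insert_subset (head_mem_reach hb.1 (hSv' hb.2)) hSv'
        · intro c hc hci hct
          rcases Nat.lt_succ_iff_lt_or_eq.1 hci with hlt | heq
          · exact Or.inr (hstep c hc hlt hct)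
          · obtain rfl : c = a := Fin.ext heq
            exact Or.inl rfl
    · rw [htest] at hb
      refine ⟨hx, ?_, S', hS', hSS', hSv', ?_⟩
      · exact h'.of_same (same_setVar _ 11 _) (by decide) (by decide)
      · intro c hc hci hct
        rcases Nat.lt_succ_iff_lt_or_eq.1 hci with hlt | heq
        · exact hstep c hc hlt hct
        · obtain rfl : c = a := Fin.ext heq
          exact absurd ⟨hc, hSS' hct⟩ hb
  · omega
  · rintro s' ⟨-, S', h1, h2, h3, h4⟩
    exact ⟨S', h1, h2, h3, fun a ha => h4 a ha a.2⟩

theorem search_runs {D : MultiDigraph (Fin n) (Fin m)} {G : Set (Fin m)} {s : State}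
    (h : SearchInput D G s) {v : Fin n} (hv : s.var 8 = v) :
    Runs search s (3 * n + 3 + (n * (5 * m + 4) + 2)) fun s' => Holds (s'.arr 6) (D.reach G v) := by
  have hclear : Runs (forRange 10 (Expr.var 0) (Prog.put 6 (Expr.var 10) (Expr.const 0))) s
      (3 * n + 2) fun s' => ∀ i < n, s'.arr 6 i = 0 := by
    refine (Runs.forRange n (fun i s' => s'.var 0 = n ∧ ∀ j < i, s'.arr 6 j = 0)
      (T := 1) ?_ ?_ ?_).mono (by omega) fun s' hs' => hs'.2
    · exact ⟨h.order, fun j hj => absurd hj (Nat.not_lt_zero _)⟩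
    · exact fun i s' hs' => hs'.1
    · rintro i hi s' hx ⟨h0, h1⟩
      refine Runs.put ⟨by simpa using hx, by simpa using h0, ?_⟩
      intro j hj
      by_cases hji : j = i
      · simp [Expr.eval, hx, hji]
      · simp [Expr.eval, hx, hji, h1 j (by omega)]
  -- A round that marks nothing new has reached the full closure, and any other round adds a vertex.
  -- After `n` rounds the second alternative would require `n + 1` marked vertices.
  refine (Runs.seq hclear.frame fun s₁ hs₁ => Runs.put_seq (Runs.forRange n (fun i s' =>
    SearchInput D G s' ∧ ∃ S, Holds (s'.arr 6) S ∧ S ⊆ D.reach G v ∧ v ∈ S ∧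
      (S = D.reach G v ∨ i + 1 ≤ S.ncard)) (T := 5 * m + 2) ?_ ?_ ?_)).mono ?_ ?_
  · have h1 : SearchInput D G s₁ := h.of_same hs₁.2 (by decide) (by decide)
    have h8 : s₁.var 8 = v := by rw [hs₁.2.1 8 (by decide), hv]
    refine ⟨(h1.of_same (same_setArr s₁ 6 _ _) (by decide) (by decide)).of_same
      (same_setVar _ 10 _) (by decide) (by decide), {v}, ?_,
      Set.singleton_subset_iff.2 mem_reach_self, rfl, Or.inr (by simp)⟩
    have hempty : Holds (s₁.arr 6) (∅ : Set (Fin n)) := fun i => by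
      rw [hs₁.1 i i.2, eq_comm, indicator_eq_zero]
      exact Set.notMem_empty i
    have := hempty.insert v
    simp only [Expr.eval, h8, State.setVar_arr]
    rwa [insert_empty_eq] at this
  · exact fun i s' hs' => hs'.1.order
  · rintro i hi s' hx ⟨h', S, hS, hSv, hvS, hi'⟩
    refine (search_round_runs h' hS hSv).frame.mono le_rfl ?_
    rintro s'' ⟨⟨S', hS', hSS', hSv', hstep⟩, hsame⟩
    refine ⟨(hsame.1 10 (by decide)).trans hx, (h'.of_same hsame (by decide) (by decide)).of_same
      (same_setVar _ 10 _) (by decide) (by decide), S', hS', hSv', hSS' hvS, ?_⟩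
    rcases hSS'.eq_or_ssubset with heq | hlt
    · exact Or.inl (hSv'.antisymm (reach_subset_of_closed (hSS' hvS)
        fun a ha hat => hstep a ha (heq ▸ hat)))
    · rcases hi' with rfl | hi'
      · exact absurd hSv' hlt.2
      · have := Set.ncard_lt_ncard hlt
        exact Or.inr (by omega)
  · exact le_of_eq (by ring)
  · rintro s' ⟨-, S, hS, -, -, rfl | hc⟩
    · exact hS
    · have := Set.ncard_le_card S
      rw [Nat.card_fin] at this
      omega

/-! ### Testing arcs -/

/-- Clears register `7` unless every vertex is reachable from the root by arcs whose entry in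
array `2` is `0`. -/
def checkSpans : Prog :=
  Prog.seq (Prog.set 8 (Expr.var 2)) (Prog.seq (Prog.set 9 (Expr.const 0)) (Prog.seq search
    (forRange 10 (Expr.var 0) (Prog.ite (Test.eq (Expr.get 6 (Expr.var 10)) (Expr.const 0))
      (Prog.set 7 (Expr.const 0)) Prog.skip))))

/-- Clears register `7` if from some vertex other than the root more than `N - k` vertices are
reachable by arcs whose entry in array `2` is `1`; here `N` is in register `4`. -/
def checkBranches : Prog :=
  forRange 14 (Expr.var 0) (Prog.ite (Test.not (Test.eq (Expr.var 14) (Expr.var 2)))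
    (Prog.seq (Prog.set 8 (Expr.var 14)) (Prog.seq (Prog.set 9 (Expr.const 1)) (Prog.seq search
      (Prog.seq (count 6)
        (Prog.ite (Test.lt (Expr.var 4) (Expr.add (Expr.var 12) (Expr.var 3)))
          (Prog.set 7 (Expr.const 0)) Prog.skip)))))
    Prog.skip)

/-- The memory holds the digraph, the numbers `k` and `N`, and two pairs of an arc set and a vertex
set. -/
structure Memory (D : RootedDigraph (Fin n) (Fin m)) (k N : ℕ) (F₁ : Set (Fin m))
    (U₁ : Set (Fin n)) (F₂ : Set (Fin m)) (U₂ : Set (Fin n)) (s : State) : Prop where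
  order : s.var 0 = n
  size : s.var 1 = m
  root : s.var 2 = D.root
  safety : s.var 3 = k
  target : s.var 4 = N
  tail : ∀ a : Fin m, s.arr 0 a = D.tail a
  head : ∀ a : Fin m, s.arr 1 a = D.head a
  arcs₁ : Holds (s.arr 2) F₁
  arcs₂ : Holds (s.arr 3) F₂
  verts₁ : Holds (s.arr 4) U₁
  verts₂ : Holds (s.arr 5) U₂

variable {D : RootedDigraph (Fin n) (Fin m)} {k N : ℕ} {F₁ F₂ : Set (Fin m)}
  {U₁ U₂ : Set (Fin n)} {s s' : State}

theorem Memory.of_same (h : Memory D k N F₁ U₁ F₂ U₂ s) {X B : List ℕ} (hs : Same X B s s')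
    (hX : ∀ x < 5, x ∉ X) (hB : ∀ b < 6, b ∉ B) : Memory D k N F₁ U₁ F₂ U₂ s' := by
  have e0 := hs.1 0 (hX 0 (by decide))
  have e1 := hs.1 1 (hX 1 (by decide))
  have e2 := hs.1 2 (hX 2 (by decide))
  have e3 := hs.1 3 (hX 3 (by decide))
  have e4 := hs.1 4 (hX 4 (by decide))
  have a0 := hs.2 0 (hB 0 (by decide))
  have a1 := hs.2 1 (hB 1 (by decide))
  have a2 := hs.2 2 (hB 2 (by decide))
  have a3 := hs.2 3 (hB 3 (by decide))
  have a4 := hs.2 4 (hB 4 (by decide))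
  have a5 := hs.2 5 (hB 5 (by decide))
  obtain ⟨h0, h1, h2, h3, h4, h5, h6, h7, h8, h9, h10⟩ := h
  exact ⟨e0 ▸ h0, e1 ▸ h1, e2 ▸ h2, e3 ▸ h3, e4 ▸ h4, a0 ▸ h5, a1 ▸ h6, a2 ▸ h7, a3 ▸ h8,
    a4 ▸ h9, a5 ▸ h10⟩

theorem Memory.searchInput_compl (h : Memory D k N F₁ U₁ F₂ U₂ s) (h9 : s.var 9 = 0) :
    SearchInput D.toMultiDigraph F₁ᶜ s := by
  refine ⟨h.order, h.size, h.tail, h.head, fun a => ?_⟩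
  rw [h9, h.arcs₁ a, indicator_eq_zero, Set.mem_compl_iff]

theorem Memory.searchInput (h : Memory D k N F₁ U₁ F₂ U₂ s) (h9 : s.var 9 = 1) :
    SearchInput D.toMultiDigraph F₁ s := by
  refine ⟨h.order, h.size, h.tail, h.head, fun a => ?_⟩
  rw [h9, h.arcs₁ a, indicator_eq_one]

theorem checkSpans_runs (h : Memory D k N F₁ U₁ F₂ U₂ s) :
    Runs checkSpans s (30 * (n + m + 1) ^ 2) fun s' =>
      s'.var 7 = 1 ↔ s.var 7 = 1 ∧ D.Spans F₁ᶜ := by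
  have h1 : Memory D k N F₁ U₁ F₂ U₂ ((s.setVar 8 (s.var 2)).setVar 9 0) :=
    (h.of_same (same_setVar s 8 _) (by decide) (by decide)).of_same
      (same_setVar _ 9 _) (by decide) (by decide)
  have hsearch := (search_runs (v := D.root) (h1.searchInput_compl (by simp))
    (by simpa using h.root)).frame
  refine (Runs.set_seq (Runs.set_seq (Runs.seq hsearch fun s₁ hs₁ =>
    (Runs.forRange n (fun i s' => s'.var 0 = n ∧ s'.arr 6 = s₁.arr 6 ∧
      (s'.var 7 = 1 ↔ s.var 7 = 1 ∧ ∀ v : Fin n, v.1 < i → v ∈ D.reach F₁ᶜ D.root))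
      (T := 3) ?_ ?_ ?_).mono le_rfl ?_))).mono ?_ fun _ => id
  · refine ⟨?_, rfl, ?_⟩
    · simpa using (hs₁.2.1 0 (by decide)).trans h1.order
    · have := hs₁.2.1 7 (by decide)
      simp at this
      simp [this]
  · exact fun i s' hs' => hs'.1
  · rintro i hi s' hx ⟨h0, h6, h7⟩
    have hind := hs₁.1 ⟨i, hi⟩
    have hsucc : (∀ v : Fin n, v.1 < i + 1 → v ∈ D.reach F₁ᶜ D.root) ↔
        (∀ v : Fin n, v.1 < i → v ∈ D.reach F₁ᶜ D.root) ∧ ⟨i, hi⟩ ∈ D.reach F₁ᶜ D.root := by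
      constructor
      · exact fun hv => ⟨fun v hvi => hv v (by omega), hv _ (Nat.lt_succ_self i)⟩
      · rintro ⟨hv, hvi⟩ v hlt
        rcases Nat.lt_succ_iff_lt_or_eq.1 hlt with hlt | heq
        · exact hv v hlt
        · obtain rfl : v = ⟨i, hi⟩ := Fin.ext heq
          exact hvi
    refine (Runs.ite (fun hb => Runs.set ?_) fun hb => Runs.skip ?_).mono (le_refl (1 + 1 + 1))
      fun _ => id
    · simp only [Test.Holds, Expr.eval, hx, h6] at hb
      rw [hind, indicator_eq_zero] at hb
      rw [hsucc]
      simp [hx, h0, h6, hb, Expr.eval]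
    · simp only [Test.Holds, Expr.eval, hx, h6] at hb
      rw [hind, indicator_eq_zero, not_not] at hb
      rw [hsucc]
      simp [hx, h0, h6, h7, hb]
  · rintro s' ⟨-, -, hs'⟩
    rw [hs']
    exact and_congr_right fun _ => ⟨fun h v => h v v.2, fun h v _ => h v⟩
  · nlinarith

theorem checkBranches_runs (h : Memory D k N F₁ U₁ F₂ U₂ s) :
    Runs checkBranches s (40 * (n + m + 1) ^ 3) fun s' =>
      s'.var 7 = 1 ↔ s.var 7 = 1 ∧ ∀ v, v ≠ D.root → (D.reach F₁ v).ncard + k ≤ N := by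
  refine (Runs.forRange n (fun i s' => Memory D k N F₁ U₁ F₂ U₂ s' ∧
    (s'.var 7 = 1 ↔ s.var 7 = 1 ∧
      ∀ v : Fin n, v.1 < i → v ≠ D.root → (D.reach F₁ v).ncard + k ≤ N))
    (T := 30 * (n + m + 1) ^ 2) ?_ ?_ ?_).mono ?_ ?_
  · exact ⟨h.of_same (same_setVar s 14 _) (by decide) (by decide), by simp⟩
  · exact fun i s' hs' => hs'.1.order
  · rintro i hi s₁ hx ⟨h₁, h7⟩
    have hsucc : (∀ v : Fin n, v.1 < i + 1 → v ≠ D.root → (D.reach F₁ v).ncard + k ≤ N) ↔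
        (∀ v : Fin n, v.1 < i → v ≠ D.root → (D.reach F₁ v).ncard + k ≤ N) ∧
          (⟨i, hi⟩ ≠ D.root → (D.reach F₁ ⟨i, hi⟩).ncard + k ≤ N) := by
      constructor
      · exact fun hv => ⟨fun v hvi => hv v (by omega), hv _ (Nat.lt_succ_self i)⟩
      · rintro ⟨hv, hvi⟩ v hlt
        rcases Nat.lt_succ_iff_lt_or_eq.1 hlt with hlt | heq
        · exact hv v hlt
        · obtain rfl : v = ⟨i, hi⟩ := Fin.ext heq
          exact hvi
    have hroot : s₁.var 14 = s₁.var 2 ↔ ⟨i, hi⟩ = D.root := by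
      rw [hx, h₁.root, Fin.ext_iff]
    have hend : ∀ {s' : State} {X B : List ℕ}, Same X B s₁ s' → (∀ x < 5, x ∉ X) →
        (∀ b < 6, b ∉ B) → Memory D k N F₁ U₁ F₂ U₂ (s'.setVar 14 (i + 1)) := fun hs hX hB =>
      (h₁.of_same hs hX hB).of_same (same_setVar _ 14 _) (by decide)
        (by decide)
    rw [hsucc]
    have hset : Same [8, 9] [] s₁ ((s₁.setVar 8 (s₁.var 14)).setVar 9 1) :=
      (same_setVar s₁ 8 _).trans (same_setVar _ 9 _)
    have h₂ : Memory D k N F₁ U₁ F₂ U₂ ((s₁.setVar 8 (s₁.var 14)).setVar 9 1) :=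
      h₁.of_same hset (by decide) (by decide)
    have hsearch := (search_runs (v := ⟨i, hi⟩)
      (h₂.searchInput (by simp)) (by simpa using hx)).frame
    refine (Runs.ite (fun hb => Runs.set_seq (Runs.set_seq (Runs.seq hsearch fun s₃ hs₃ =>
      Runs.seq (count_runs (S := D.reach F₁ ⟨i, hi⟩) ?_ hs₃.1).frame
        fun s₄ hs₄ => Runs.ite (fun hc => Runs.set ?_) fun hc => Runs.skip ?_)))
      fun hb => Runs.skip ?_).mono ?_ fun _ => id
    · exact (hs₃.2.1 0 (by decide)).trans h₂.order
    all_goals try simp only [Test.Holds, Expr.eval, not_not] at hb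
    · have hs := (hset.trans hs₃.2).trans hs₄.2
      have h₄ := h₁.of_same hs (by decide) (by decide)
      simp only [Test.Holds, Expr.eval, h₄.target, h₄.safety, hs₄.1] at hc
      refine ⟨?_, ?_, ?_⟩
      · simpa using (hs.1 14 (by decide)).trans hx
      · exact hend (hs.trans (same_setVar s₄ 7 _)) (by decide) (by decide)
      · rw [hroot] at hb
        simp only [Expr.eval, State.setVar_var, Nat.reduceEqDiff, if_true, if_false]
        constructor
        · intro hf
          exact absurd hf (by decide)
        · rintro ⟨-, -, hf⟩
          exact absurd (hf hb) (not_le.2 hc)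
    · have hs := (hset.trans hs₃.2).trans hs₄.2
      have h₄ := h₁.of_same hs (by decide) (by decide)
      simp only [Test.Holds, Expr.eval, h₄.target, h₄.safety, hs₄.1, not_lt] at hc
      refine ⟨(hs.1 14 (by decide)).trans hx, hend hs (by decide) (by decide), ?_⟩
      have e7 : s₄.var 7 = s₁.var 7 := hs.1 7 (by decide)
      simp only [State.setVar_var, Nat.reduceEqDiff, if_false, e7]
      rw [h7]
      tauto
    · rw [hroot] at hb
      refine ⟨hx, hend (X := []) (B := []) ⟨fun _ _ => rfl, fun _ _ => rfl⟩ (by decide)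
        (by decide), ?_⟩
      simp only [State.setVar_var, Nat.reduceEqDiff, if_false]
      rw [h7]
      tauto
    · nlinarith
  · have h2 : 1 ≤ (n + m + 1) ^ 2 := Nat.one_le_pow _ _ (by omega)
    have : n * (30 * (n + m + 1) ^ 2 + 2) ≤ (n + m + 1) * (32 * (n + m + 1) ^ 2) :=
      Nat.mul_le_mul (by omega) (by omega)
    have h1 : 1 ≤ (n + m + 1) ^ 3 := Nat.one_le_pow _ _ (by omega)
    calc _ ≤ (n + m + 1) * (32 * (n + m + 1) ^ 2) + 2 := by omega
      _ = 32 * (n + m + 1) ^ 3 + 2 := by ring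
      _ ≤ _ := by omega
  · rintro s' ⟨-, hs'⟩
    rw [hs']
    exact and_congr_right fun _ => ⟨fun h v => h v v.2, fun h v _ => h v⟩

end RAM

namespace RAM

open MultiDigraph RootedDigraph

variable {n m : ℕ} {D : RootedDigraph (Fin n) (Fin m)} {k N : ℕ} {F₁ F₂ : Set (Fin m)}
  {U₁ U₂ : Set (Fin n)} {s s' : State}

/-! ### The greedy procedure as a program -/

theorem Memory.insert_arc (h : Memory D k N F₁ U₁ F₂ U₂ s) (a : Fin m) :
    Memory D k N (insert a F₁) U₁ F₂ U₂ (s.setArr 2 a 1) := by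
  have hs := same_setArr s 2 a 1
  obtain ⟨h0, h1, h2, h3, h4, h5, h6, h7, h8, h9, h10⟩ := h
  refine ⟨h0, h1, h2, h3, h4, ?_, ?_, h7.insert a, ?_, ?_, ?_⟩
  · rwa [hs.2 0 (by decide)]
  · rwa [hs.2 1 (by decide)]
  · rwa [hs.2 3 (by decide)]
  · rwa [hs.2 4 (by decide)]
  · rwa [hs.2 5 (by decide)]

theorem Memory.sdiff_arc (h : Memory D k N F₁ U₁ F₂ U₂ s) (a : Fin m) :
    Memory D k N (F₁ \ {a}) U₁ F₂ U₂ (s.setArr 2 a 0) := by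
  have hs := same_setArr s 2 a 0
  obtain ⟨h0, h1, h2, h3, h4, h5, h6, h7, h8, h9, h10⟩ := h
  refine ⟨h0, h1, h2, h3, h4, ?_, ?_, h7.sdiff a, ?_, ?_, ?_⟩
  · rwa [hs.2 0 (by decide)]
  · rwa [hs.2 1 (by decide)]
  · rwa [hs.2 3 (by decide)]
  · rwa [hs.2 4 (by decide)]
  · rwa [hs.2 5 (by decide)]

theorem Memory.insert_vert (h : Memory D k N F₁ U₁ F₂ U₂ s) (v : Fin n) :
    Memory D k N F₁ (insert v U₁) F₂ U₂ (s.setArr 4 v 1) := by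
  have hs := same_setArr s 4 v 1
  obtain ⟨h0, h1, h2, h3, h4, h5, h6, h7, h8, h9, h10⟩ := h
  refine ⟨h0, h1, h2, h3, h4, ?_, ?_, ?_, ?_, h9.insert v, ?_⟩
  · rwa [hs.2 0 (by decide)]
  · rwa [hs.2 1 (by decide)]
  · rwa [hs.2 2 (by decide)]
  · rwa [hs.2 3 (by decide)]
  · rwa [hs.2 5 (by decide)]

/-- Adds the arc in register `6` to the first tree, if this is admissible, and then restarts the
scan of the arcs; otherwise moves on to the next arc. Register `5` counts the vertices. -/
def tryArc : Prog :=
  Prog.ite (Test.and (Test.and (Test.eq (Expr.get 4 (Expr.get 0 (Expr.var 6))) (Expr.const 1))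
      (Test.eq (Expr.get 4 (Expr.get 1 (Expr.var 6))) (Expr.const 0)))
      (Test.eq (Expr.get 3 (Expr.var 6)) (Expr.const 0)))
    (Prog.seq (Prog.put 2 (Expr.var 6) (Expr.const 1)) (Prog.seq (Prog.set 7 (Expr.const 1))
      (Prog.seq checkSpans (Prog.seq checkBranches
        (Prog.ite (Test.eq (Expr.var 7) (Expr.const 1))
          (Prog.seq (Prog.put 4 (Expr.get 1 (Expr.var 6)) (Expr.const 1))
            (Prog.seq (Prog.set 5 (Expr.add (Expr.var 5) (Expr.const 1)))
              (Prog.set 6 (Expr.const 0))))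
          (Prog.seq (Prog.put 2 (Expr.var 6) (Expr.const 0))
            (Prog.set 6 (Expr.add (Expr.var 6) (Expr.const 1)))))))))
    (Prog.set 6 (Expr.add (Expr.var 6) (Expr.const 1)))

theorem tryArc_runs (h : Memory D k N F₁ U₁ F₂ U₂ s) (hF : ∀ a ∈ F₁, D.head a ∈ U₁) {a : Fin m}
    (ha : s.var 6 = a) :
    Runs tryArc s (90 * (n + m + 1) ^ 3) fun s' =>
      (D.IsAdmissible F₁ U₁ F₂ k N a ∧
        Memory D k N (insert a F₁) (insert (D.head a) U₁) F₂ U₂ s' ∧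
          s'.var 5 = s.var 5 + 1 ∧ s'.var 6 = 0) ∨
      (¬ D.IsAdmissible F₁ U₁ F₂ k N a ∧ Memory D k N F₁ U₁ F₂ U₂ s' ∧
        s'.var 5 = s.var 5 ∧ s'.var 6 = a + 1) := by
  have htest : (Test.and
      (Test.and (Test.eq (Expr.get 4 (Expr.get 0 (Expr.var 6))) (Expr.const 1))
        (Test.eq (Expr.get 4 (Expr.get 1 (Expr.var 6))) (Expr.const 0)))
      (Test.eq (Expr.get 3 (Expr.var 6)) (Expr.const 0))).Holds s ↔
      (D.tail a ∈ U₁ ∧ D.head a ∉ U₁) ∧ a ∉ F₂ := by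
    simp only [Test.Holds, Expr.eval, ha, h.tail a, h.head a, h.verts₁ _, h.arcs₂ _,
      indicator_eq_zero, indicator_eq_one]
  have h₁ : Memory D k N (insert a F₁) U₁ F₂ U₂ ((s.setArr 2 a 1).setVar 7 1) :=
    (h.insert_arc a).of_same (same_setVar _ 7 _) (by decide) (by decide)
  have hset : Same [7] [2] s ((s.setArr 2 a 1).setVar 7 1) :=
    (same_setArr s 2 a 1).trans (same_setVar _ 7 1)
  have heval : ((s.setArr 2 (Expr.eval s (Expr.var 6)) (Expr.eval s (Expr.const 1))).setVar 7
      (Expr.eval (s.setArr 2 (Expr.eval s (Expr.var 6)) (Expr.eval s (Expr.const 1)))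
        (Expr.const 1))) = (s.setArr 2 a 1).setVar 7 1 := by
    simp only [Expr.eval, ha]
  have hM : 1 ≤ (n + m + 1) ^ 2 := Nat.one_le_pow _ _ (by omega)
  have hM' : (n + m + 1) ^ 2 ≤ (n + m + 1) ^ 3 := Nat.pow_le_pow_right (by omega) (by omega)
  refine (Runs.ite (T := 85 * (n + m + 1) ^ 3) (fun hb =>
    (Runs.put_seq (Runs.set_seq (T := 80 * (n + m + 1) ^ 3) ?_)).mono (by omega) fun _ => id)
    fun hb => Runs.set ?_).mono ?_ fun _ => id
  · rw [htest] at hb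
    rw [heval]
    refine (Runs.seq (checkSpans_runs h₁).frame fun s₂ hs₂ =>
      Runs.seq (checkBranches_runs (h₁.of_same hs₂.2 (by decide) (by decide))).frame fun s₃ hs₃ =>
      Runs.ite (fun hc => Runs.put_seq (Runs.set_seq (Runs.set ?_)))
        fun hc => Runs.put_seq (Runs.set ?_)).mono (by omega) fun _ => id
    all_goals
      have hs := (hset.trans hs₂.2).trans hs₃.2
      have h₃ := (h₁.of_same hs₂.2 (by decide) (by decide)).of_same hs₃.2 (by decide) (by decide)
      have e6 : s₃.var 6 = a := (hs.1 6 (by decide)).trans ha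
      have e5 : s₃.var 5 = s.var 5 := hs.1 5 (by decide)
    · have hc' : s₃.var 7 = 1 := hc
      rw [hs₃.1, hs₂.1] at hc'
      refine Or.inl ⟨⟨hb.1.1, hb.1.2, hb.2, hc'.1.2, hc'.2⟩, ?_, ?_, ?_⟩
      · simp only [Expr.eval, e6, h₃.head a]
        exact ((h₃.insert_vert (D.head a)).of_same (same_setVar _ 5 _) (by decide)
          (by decide)).of_same (same_setVar _ 6 _) (by decide) (by decide)
      · simp [Expr.eval, e5]
      · simp [Expr.eval]
    · have hc' : ¬ s₃.var 7 = 1 := hc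
      rw [hs₃.1, hs₂.1] at hc'
      refine Or.inr ⟨fun hA => hc' ⟨⟨by simp, hA.spans⟩, hA.branch_le⟩, ?_, ?_, ?_⟩
      · have h₄ := h₃.sdiff_arc a
        -- Undoing the tentative insertion restores `F₁` only if `a` was not there before, which
        -- holds since its head is outside `U₁`.
        rw [Set.insert_sdiff_self_of_notMem fun haF => hb.1.2 (hF a haF)] at h₄
        simp only [Expr.eval, e6]
        exact h₄.of_same (same_setVar _ 6 _) (by decide) (by decide)
      · simp [e5]
      · simp [Expr.eval, e6]
  · rw [htest] at hb
    refine Or.inr ⟨fun hA => hb ⟨⟨hA.tail_mem, hA.head_notMem⟩, hA.notMem⟩,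
      h.of_same (same_setVar _ 6 _) (by decide) (by decide), ?_, ?_⟩
    · simp
    · simp [Expr.eval, ha]
  · omega

/-- Adds arcs to the first tree until it has as many vertices as register `4` says. -/
def grow : Prog :=
  Prog.seq (count 4) (Prog.seq (Prog.set 5 (Expr.var 12)) (Prog.seq (Prog.set 6 (Expr.const 0))
    (Prog.loop (Test.lt (Expr.var 5) (Expr.var 4)) tryArc)))

theorem grow_runs {I : Set (Fin m) → Set (Fin n) → Prop} (hI : D.IsGreedy F₂ k N I)
    (hN : N ≤ n) (h : Memory D k N F₁ U₁ F₂ U₂ s) (hI₁ : I F₁ U₁) :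
    Runs grow s (200 * (n + m + 1) ^ 5) fun s' =>
      ∃ F U, I F U ∧ N ≤ U.ncard ∧ Memory D k N F U F₂ U₂ s' := by
  let J : State → Prop := fun s' => ∃ F U, I F U ∧ Memory D k N F U F₂ U₂ s' ∧
    s'.var 5 = U.ncard ∧ ∀ a : Fin m, a.1 < s'.var 6 → ¬ D.IsAdmissible F U F₂ k N a
  -- Lexicographic variant: a new vertex pays `m + 1`, which covers restarting the scan. The restart
  -- is needed because a larger tree may make earlier arcs admissible.
  let φ : State → ℕ := fun s' => (N - s'.var 5) * (m + 1) + (m - s'.var 6)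
  have hbody : ∀ s₁, J s₁ → (Test.lt (Expr.var 5) (Expr.var 4)).Holds s₁ →
      Runs tryArc s₁ (90 * (n + m + 1) ^ 3) fun s' => J s' ∧ φ s' < φ s₁ := by
    rintro s₁ ⟨F, U, hIF, hM, h5, hno⟩ hlt
    have hlt' : s₁.var 5 < s₁.var 4 := hlt
    rw [hM.target] at hlt'
    obtain ⟨b, hb⟩ := hI.exists_arc F U hIF (h5 ▸ hlt')
    -- All arcs before the scan position are inadmissible, so the admissible arc `b` lies ahead and
    -- the scan never runs past `m`.
    have hbm : s₁.var 6 ≤ b.1 := not_lt.1 fun hc => hno b hc hb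
    have h6 : s₁.var 6 < m := hbm.trans_lt b.2
    let a : Fin m := ⟨s₁.var 6, h6⟩
    refine (tryArc_runs hM (hI.head_mem F U hIF) (a := a) rfl).mono le_rfl ?_
    rintro s₂ (⟨hA, hM₂, e5, e6⟩ | ⟨hA, hM₂, e5, e6⟩)
    · refine ⟨⟨_, _, hI.insert_arc F U a hIF (h5 ▸ hlt') hA, hM₂, ?_, ?_⟩, ?_⟩
      · rw [e5, h5, Set.ncard_insert_of_notMem hA.head_notMem]
      · intro c hc
        rw [e6] at hc
        exact absurd hc (Nat.not_lt_zero _)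
      · simp only [φ, e5, e6]
        obtain ⟨d, hd⟩ : ∃ d, N - s₁.var 5 = d + 1 := ⟨N - s₁.var 5 - 1, by omega⟩
        have hd' : N - (s₁.var 5 + 1) = d := by omega
        rw [hd, hd', Nat.add_mul]
        omega
    · refine ⟨⟨F, U, hIF, hM₂, e5.trans h5, ?_⟩, ?_⟩
      · intro c hc
        rw [e6] at hc
        rcases Nat.lt_succ_iff_lt_or_eq.1 hc with hlt | heq
        · exact hno c hlt
        · obtain rfl : c = a := Fin.ext heq
          exact hA
      · simp only [φ, e5, e6]
        have : a.1 = s₁.var 6 := rfl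
        omega
  refine (Runs.seq (T' := 1 + (1 + (2 * (n + m + 1) ^ 2 * (90 * (n + m + 1) ^ 3 + 1) + 1)))
    (count_runs h.order h.verts₁).frame fun s₁ hs₁ => Runs.set_seq (Runs.set_seq
      ((Runs.loop J φ hbody ?_).mono ?_ ?_))).mono ?_ fun _ => id
  · refine ⟨F₁, U₁, hI₁, ((h.of_same hs₁.2 (by decide) (by decide)).of_same (same_setVar _ 5 _)
      (by decide) (by decide)).of_same (same_setVar _ 6 _) (by decide) (by decide), ?_, ?_⟩
    · simp [Expr.eval, hs₁.1]
    · intro a ha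
      simp [Expr.eval] at ha
  · refine Nat.add_le_add_right (Nat.mul_le_mul_right _ ?_) 1
    have h1 : ∀ c d : ℕ, (N - c) * (m + 1) + (m - d) ≤ n * (m + 1) + m := fun c d =>
      Nat.add_le_add (Nat.mul_le_mul_right _ (by omega)) (Nat.sub_le _ _)
    refine (h1 _ _).trans ?_
    nlinarith
  · rintro s' ⟨⟨F, U, hIF, hM, h5, -⟩, hlt⟩
    have hlt' : ¬ s'.var 5 < s'.var 4 := hlt
    rw [hM.target, h5, not_lt] at hlt'
    exact ⟨F, U, hIF, hlt', hM⟩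
  · have h1 : (n + m + 1) ≤ (n + m + 1) ^ 5 := Nat.le_self_pow (by omega) _
    have h2 : (n + m + 1) ^ 2 ≤ (n + m + 1) ^ 5 := Nat.pow_le_pow_right (by omega) (by omega)
    have h3 : 2 * (n + m + 1) ^ 2 * (90 * (n + m + 1) ^ 3 + 1) =
        180 * (n + m + 1) ^ 5 + 2 * (n + m + 1) ^ 2 := by ring
    omega

/-! ### Exchanging the trees, output and the complete algorithm -/

/-- Exchanges the first entries of two arrays; their number is in register `x`. -/
def swapArrays (x b c : ℕ) : Prog :=
  forRange 10 (Expr.var x) (Prog.seq (Prog.set 13 (Expr.get b (Expr.var 10)))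
    (Prog.seq (Prog.put b (Expr.var 10) (Expr.get c (Expr.var 10)))
      (Prog.put c (Expr.var 10) (Expr.var 13))))

theorem swapArrays_runs {x b c l : ℕ} (hbc : b ≠ c) (hx : s.var x = l) (hx10 : x ≠ 10)
    (hx13 : x ≠ 13) : Runs (swapArrays x b c) s (5 * l + 2) fun s' =>
      ∀ i < l, s'.arr b i = s.arr c i ∧ s'.arr c i = s.arr b i := by
  refine (Runs.forRange l (fun i s' => s'.var x = l ∧
    (∀ j < i, s'.arr b j = s.arr c j ∧ s'.arr c j = s.arr b j) ∧
      ∀ j, i ≤ j → s'.arr b j = s.arr b j ∧ s'.arr c j = s.arr c j) (T := 1 + (1 + 1))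
    ?_ ?_ ?_).mono (by omega) fun s' hs' => hs'.2.1
  · refine ⟨by simp [hx10, hx], fun j hj => absurd hj (Nat.not_lt_zero _), fun j _ => ⟨rfl, rfl⟩⟩
  · exact fun i s' hs' => hs'.1
  · rintro i hi s₁ h10 ⟨h0, h1, h2⟩
    refine Runs.set_seq (Runs.put_seq (Runs.put ⟨by simpa using h10, ?_, ?_, ?_⟩))
    · simp [hx10, hx13, h0]
    · intro j hj
      by_cases hji : j = i
      · simp [Expr.eval, h10, hji, hbc, (h2 i le_rfl).1, (h2 i le_rfl).2]
      · simp [Expr.eval, h10, hji, h1 j (by omega)]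
    · intro j hj
      have hji : j ≠ i := by omega
      simp [Expr.eval, h10, hji, h2 j (by omega)]

/-- Exchanges the two trees. -/
def swapTrees : Prog := Prog.seq (swapArrays 1 2 3) (swapArrays 0 4 5)

theorem swapTrees_runs (h : Memory D k N F₁ U₁ F₂ U₂ s) :
    Runs swapTrees s (10 * (n + m + 1) ^ 5) (Memory D k N F₂ U₂ F₁ U₁) := by
  have h5 : n + m + 1 ≤ (n + m + 1) ^ 5 := Nat.le_self_pow (by omega) _
  have hfirst := (swapArrays_runs (b := 2) (c := 3) (by decide) h.size (by decide)
    (by decide)).frame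
  refine (Runs.seq hfirst fun s₁ hs₁ => (swapArrays_runs (b := 4) (c := 5) (l := n) (by decide)
    ((hs₁.2.1 0 (by decide)).trans h.order) (by decide) (by decide)).frame.mono le_rfl
      ?_).mono (by omega) fun _ => id
  rintro s₂ ⟨h45, hs₂⟩
  have hs := hs₁.2.trans hs₂
  have e2 := hs₂.2 2 (by decide)
  have e3 := hs₂.2 3 (by decide)
  have e4 := hs₁.2.2 4 (by decide)
  have e5 := hs₁.2.2 5 (by decide)
  refine ⟨(hs.1 0 (by decide)).trans h.order, (hs.1 1 (by decide)).trans h.size,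
    (hs.1 2 (by decide)).trans h.root, (hs.1 3 (by decide)).trans h.safety,
    (hs.1 4 (by decide)).trans h.target, ?_, ?_, ?_, ?_, ?_, ?_⟩
  · rw [hs.2 0 (by decide)]
    exact h.tail
  · rw [hs.2 1 (by decide)]
    exact h.head
  · intro a
    rw [e2, (hs₁.1 a a.2).1, h.arcs₂]
  · intro a
    rw [e3, (hs₁.1 a a.2).2, h.arcs₁]
  · intro v
    rw [(h45 v v.2).1, e5, h.verts₂]
  · intro v
    rw [(h45 v v.2).2, e4, h.verts₁]

/-- Copies the arc sets of the two trees into the output arrays. -/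
def output : Prog :=
  forRange 10 (Expr.var 1) (Prog.seq (Prog.put 0 (Expr.var 10) (Expr.get 2 (Expr.var 10)))
    (Prog.put 1 (Expr.var 10) (Expr.get 3 (Expr.var 10))))

theorem output_runs (h : Memory D k N F₁ U₁ F₂ U₂ s) :
    Runs output s (4 * m + 2) fun s' => OutputIs s' F₁ F₂ := by
  refine (Runs.forRange m (fun i s' => s'.var 1 = m ∧ s'.arr 2 = s.arr 2 ∧ s'.arr 3 = s.arr 3 ∧
    ∀ j < i, s'.arr 0 j = s.arr 2 j ∧ s'.arr 1 j = s.arr 3 j) (T := 1 + 1) ?_ ?_ ?_).mono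
    (by omega) ?_
  · exact ⟨by simp [h.size], rfl, rfl, fun j hj => absurd hj (Nat.not_lt_zero _)⟩
  · exact fun i s' hs' => hs'.1
  · rintro i hi s₁ h10 ⟨h1, h2, h3, h4⟩
    have hs := (same_setArr s₁ 0 i (s.arr 2 i)).trans (same_setArr _ 1 i (s.arr 3 i))
    refine Runs.put_seq (Runs.put ?_)
    have heval : ((s₁.setArr 0 (Expr.eval s₁ (Expr.var 10))
        (Expr.eval s₁ (Expr.get 2 (Expr.var 10)))).setArr 1
        (Expr.eval (s₁.setArr 0 (Expr.eval s₁ (Expr.var 10))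
          (Expr.eval s₁ (Expr.get 2 (Expr.var 10)))) (Expr.var 10))
        (Expr.eval (s₁.setArr 0 (Expr.eval s₁ (Expr.var 10))
          (Expr.eval s₁ (Expr.get 2 (Expr.var 10)))) (Expr.get 3 (Expr.var 10)))) =
        (s₁.setArr 0 i (s.arr 2 i)).setArr 1 i (s.arr 3 i) := by
      simp [Expr.eval, h10, h2, h3]
    rw [heval]
    refine ⟨h10, by simpa using h1, (hs.2 2 (by decide)).trans h2, (hs.2 3 (by decide)).trans h3,
      ?_⟩
    intro j hj
    by_cases hji : j = i
    · simp [hji]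
    · simp [hji, h4 j (by omega)]
  · rintro s' ⟨-, -, -, h4⟩ a
    rw [(h4 a a.2).1, (h4 a a.2).2]
    exact ⟨h.arcs₁ a, h.arcs₂ a⟩

/-- The algorithm: both kernels grow to `2k-1` vertices, and then both trees to `n` vertices. -/
def extendKernels : Prog :=
  Prog.seq (Prog.set 4 (Expr.sub (Expr.add (Expr.var 3) (Expr.var 3)) (Expr.const 1)))
    (Prog.seq grow (Prog.seq swapTrees (Prog.seq grow (Prog.seq swapTrees
      (Prog.seq (Prog.set 4 (Expr.var 0))
        (Prog.seq grow (Prog.seq swapTrees (Prog.seq grow (Prog.seq swapTrees output)))))))))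

theorem Memory.set_target (h : Memory D k N F₁ U₁ F₂ U₂ s) {e : Expr} {N' : ℕ}
    (he : e.eval s = N') : Memory D k N' F₁ U₁ F₂ U₂ (s.setVar 4 (e.eval s)) := by
  obtain ⟨h0, h1, h2, h3, -, h5, h6, h7, h8, h9, h10⟩ := h
  exact ⟨by simpa using h0, by simpa using h1, by simpa using h2, by simpa using h3,
    by simpa using he, h5, h6, h7, h8, h9, h10⟩

theorem inputState_memory (X₁ X₂ : D.Sub) :
    Memory D k 0 X₁.arcs X₁.verts X₂.arcs X₂.verts (inputState D k X₁ X₂) := by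
  refine ⟨rfl, rfl, rfl, rfl, rfl, ?_, ?_, fun _ => rfl, fun _ => rfl, fun _ => rfl,
    fun _ => rfl⟩ <;> intro a <;> simp [inputState, tabulate]

theorem extendKernels_runs (hk : 1 ≤ k) (h2 : D.IsRootConnected D.root 2) (hn : 2 * k - 1 ≤ n)
    {X₁ X₂ : D.Sub} (h : D.IsCompactKernelPair k X₁ X₂) :
    Runs extendKernels (inputState D k X₁ X₂) (900 * (n + m + 1) ^ 5) fun s' =>
      ∃ T₁ T₂ : D.Sub, D.IsSafePacking k T₁ T₂ ∧ OutputIs s' T₁.arcs T₂.arcs := by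
  have hk₁ := h.1.isKernelTree hk
  have hk₂ := h.2.1.isKernelTree hk
  have hX₂ : X₂.verts.ncard ≤ 2 * k - 1 := by
    obtain ⟨-, t, -, ht, -⟩ := hk₂
    omega
  have hcard : Nat.card (Fin n) = n := Nat.card_fin n
  have h5 : n + m + 1 ≤ (n + m + 1) ^ 5 := Nat.le_self_pow (by omega) _
  have heval : (Expr.sub (Expr.add (Expr.var 3) (Expr.var 3)) (Expr.const 1)).eval
      (inputState D k X₁ X₂) = 2 * k - 1 := by
    rw [Nat.two_mul]
    rfl
  refine (Runs.set_seq
    (Runs.seq (grow_runs (KernelPhase.isGreedy h2 hk₁ hX₂) hn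
      ((inputState_memory X₁ X₂).set_target heval)
      (KernelPhase.start hk₁ (h.isPair hk))) ?_)).mono
    (T := 1 + (200 * (n + m + 1) ^ 5 + (650 * (n + m + 1) ^ 5 + 5))) (by omega) fun _ => id
  rintro s₁ ⟨F₁, U₁, hI₁, hU₁, hm₁⟩
  refine (Runs.seq (swapTrees_runs hm₁) fun s₂ hm₂ =>
    Runs.seq (grow_runs (KernelPhase.isGreedy h2 hk₂ hI₁.2.2.2.1) hn hm₂
      (KernelPhase.start hk₂ hI₁.1.symm)) ?_).mono
    (T := 10 * (n + m + 1) ^ 5 + (200 * (n + m + 1) ^ 5 + (440 * (n + m + 1) ^ 5 + 5))) (by omega)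
      fun _ => id
  rintro s₃ ⟨F₂, U₂, hI₂, hU₂, hm₃⟩
  have hgreedy : ∀ (F : Set (Fin m)) (U : Set (Fin n)),
      D.IsGreedy F k n (D.SpanningPhase k F U) := by
    intro F U
    have := SpanningPhase.isGreedy (F₂ := F) (U₂ := U) (k := k) h2
    rwa [hcard] at this
  refine (Runs.seq (swapTrees_runs hm₃) fun s₄ hm₄ => Runs.set_seq
    (Runs.seq (grow_runs (hgreedy F₂ U₂) le_rfl (hm₄.set_target (e := Expr.var 0) hm₄.order)
      ⟨hI₂.1.symm, hI₁.safeTree hU₁ hk⟩) ?_)).mono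
    (T := 10 * (n + m + 1) ^ 5 + (1 + (200 * (n + m + 1) ^ 5 + (225 * (n + m + 1) ^ 5 + 3))))
      (by omega) fun _ => id
  rintro s₅ ⟨F₁', U₁', hI₁', hU₁', hm₅⟩
  refine (Runs.seq (swapTrees_runs hm₅) fun s₆ hm₆ =>
    Runs.seq (grow_runs (hgreedy F₁' U₁') le_rfl hm₆ ⟨hI₁'.1.symm, hI₂.safeTree hU₂ hk⟩) ?_).mono
    (T := 10 * (n + m + 1) ^ 5 + (200 * (n + m + 1) ^ 5 + (14 * (n + m + 1) ^ 5 + 2))) (by omega)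
      fun _ => id
  rintro s₇ ⟨F₂', U₂', hI₂', hU₂', hm₇⟩
  refine (Runs.seq (swapTrees_runs hm₇) fun s₈ hm₈ => (output_runs hm₈).mono le_rfl ?_).mono
    (by omega) fun _ => id
  intro s₉ hout
  exact ⟨_, _, hI₂'.1.symm.isSafePacking hI₁'.2 hI₂'.2 (hcard.trans_le hU₁') (hcard.trans_le hU₂'),
    hout⟩

end RAM

theorem lemma3p1 :
    (∀ (V : Type*) (A : Type*) [Finite V] [Finite A] (D : RootedDigraph V A) (k : ℕ),
      1 ≤ k → D.IsRootConnected D.root 2 → 2 * k - 2 ≤ Nat.card {x : V // x ≠ D.root} →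
        ((∃ T₁ T₂ : D.Sub, D.IsSafePacking k T₁ T₂) ↔
          ∃ X₁ X₂ : D.Sub, D.IsCompactKernelPair k X₁ X₂)) ∧
    ∃ (P : RAM.Prog) (p : Polynomial ℕ),
      ∀ (n m : ℕ) (D : RootedDigraph (Fin n) (Fin m)) (k : ℕ),
        1 ≤ k → D.IsRootConnected D.root 2 →
        2 * k - 2 ≤ Nat.card {x : Fin n // x ≠ D.root} →
        ∀ X₁ X₂ : D.Sub, D.IsCompactKernelPair k X₁ X₂ →
          ∃ (s : RAM.State) (t : ℕ) (T₁ T₂ : D.Sub),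
            RAM.Exec P (RAM.inputState D k X₁ X₂) s t ∧ t ≤ p.eval (n + m) ∧
            D.IsSafePacking k T₁ T₂ ∧ RAM.OutputIs s T₁.arcs T₂.arcs := by
  have hcard : ∀ (V : Type _) [Finite V] (r : V),
      Nat.card {x : V // x ≠ r} + 1 = Nat.card V := by
    intro V _ r
    rw [← Set.ncard_univ V, ← Set.ncard_sdiff_singleton_add_one (Set.mem_univ r),
      ← Set.compl_eq_univ_sdiff]
    rfl
  constructor
  · intro V A _ _ D k hk h2 hV
    constructor
    · rintro ⟨T₁, T₂, h⟩
      exact h.exists_kernelPair hk hV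
    · rintro ⟨X₁, X₂, h⟩
      exact h.exists_packing hk h2
  · refine ⟨RAM.extendKernels, 900 * (Polynomial.X + 1) ^ 5, ?_⟩
    intro n m D k hk h2 hV X₁ X₂ h
    -- Counting the root as well, the first target `2k-1` is at most `n`, as the time bound for
    -- `grow` requires.
    have hn : 2 * k - 1 ≤ n := by
      have := hcard (Fin n) D.root
      rw [Nat.card_fin] at this
      omega
    obtain ⟨s, t, he, ht, T₁, T₂, hT, hout⟩ := RAM.extendKernels_runs hk h2 hn h
    refine ⟨s, t, T₁, T₂, he, ht.trans (le_of_eq ?_), hT, hout⟩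
    simp
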